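/- Theorem 1.1. A non-increasing sequence $\pi=(d_1,\dots,d_n)$ of nonnegative integers is graphic if it is the degree sequence of a simple graph on $n$ vertices (a realization of $\pi$); write $\sigma(\pi)=d_1+\dots+d_n$. For a graph $H$, $\pi$ is potentially $H$-graphic if some realization of $\pi$ contains $H$ as a (not necessarily induced) subgraph, and $\sigma(H,n)$ denotes the minimum even integer $l$ such that every $n$-term graphic sequence $\pi$ with $\sigma(\pi)\ge l$ is potentially $H$-graphic. Let $K_3\cup P_3$ be the disjoint union of a triangle and a path with three edges (four vertices), and for $r\ge 6$ let $K_{r+1}-(K_3\cup P_3)$ be the graph obtained from the complete graph $K_{r+1}$ by deleting the edges of a copy of $K_3\cup P_3$. If $r\ge 6$ and $n\ge 5r+18$, then $$\sigma(K_{r+1}-(K_3\cup P_3),n)=\begin{cases}(r-1)(2n-r)-3(n-r)-1,&\text{if } n-r \text{ is odd},\\(r-1)(2n-r)-3(n-r),&\text{if } n-r\text{ is even}.\end{cases}$$ -/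

import Mathlib

/-- `G`, a simple graph on the `n` vertices `0, …, n - 1`, realizes the sequence `d`:
vertex `i` has degree `d i`. -/
def Realizes {n : ℕ} (G : SimpleGraph (Fin n)) (d : Fin n → ℕ) : Prop :=
  ∀ i, (G.neighborSet i).ncard = d i

/-- An `n`-term graphic sequence: a non-increasing sequence of nonnegative integers that is the
degree sequence of some simple graph on `n` vertices. -/
def IsGraphic {n : ℕ} (d : Fin n → ℕ) : Prop :=
  Antitone d ∧ ∃ G : SimpleGraph (Fin n), Realizes G d

/-- `d` is potentially `H`-graphic: some realization of `d` contains `H` as a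
(not necessarily induced) subgraph. -/
def PotentiallyGraphic {V : Type*} (H : SimpleGraph V) {n : ℕ} (d : Fin n → ℕ) : Prop :=
  ∃ G : SimpleGraph (Fin n), Realizes G d ∧ H.IsContained G

/-- `l = σ(H, n)`: `l` is the minimum even integer such that every `n`-term graphic sequence
with sum at least `l` is potentially `H`-graphic. -/
def IsSigma {V : Type*} (H : SimpleGraph V) (n : ℕ) (l : ℤ) : Prop :=
  IsLeast {l : ℤ | Even l ∧
    ∀ d : Fin n → ℕ, IsGraphic d → l ≤ ∑ i, (d i : ℤ) → PotentiallyGraphic H d} l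

/-- `K_m - H`: the complete graph on `m` vertices with the edges of (a copy of) `H` removed,
where `f` says how `H` sits inside `K_m`. -/
def completeMinus {W : Type*} {m : ℕ} (H : SimpleGraph W) (f : W ↪ Fin m) :
    SimpleGraph (Fin m) :=
  (⊤ : SimpleGraph (Fin m)) \ H.map f

/-- `K_3 ∪ P_3`: the disjoint union of a triangle and a path with `3` edges
(hence on `4` vertices). -/
def triangleUnionPath : SimpleGraph (Fin 3 ⊕ Fin 4) :=
  SimpleGraph.sum (⊤ : SimpleGraph (Fin 3)) (SimpleGraph.pathGraph 4)

/-- `K_3 ∪ P_3` fits inside `K_{r+1}` as soon as `r ≥ 6`. -/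
theorem nonempty_triangleUnionPath_embedding {r : ℕ} (hr : 6 ≤ r) :
    Nonempty (Fin 3 ⊕ Fin 4 ↪ Fin (r + 1)) :=
  ⟨finSumFinEquiv.toEmbedding.trans (Fin.castLEEmb (by omega))⟩

/-!
Lower bound: take `r - 3` entries `n - 1` and make all others `r - 2`, up to parity.  A realization
consists of `r - 3` vertices joined to everything and a graph whose degrees are `1`, except for at
most one `2`; but any four vertices of `K_{r+1} - (K_3 ∪ P_3)` span at least three edges.

Upper bound: the large sum forces the first `r - 4` degrees to be large and the next ones to be at
least about `r - 1`.  Depending on where the degrees drop below `r`, some graph `K_s ∨ Γ` containing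
`K_{r+1} - (K_3 ∪ P_3)`, with `Γ` one of `3K_1`, `C_4`, `P_3`, `K_{3,3}` and the wheel `W_4` less a
spoke, can be prescribed on vertices of suitable degrees.  Its edges are kept fixed while the
vertices outside this core are saturated one at a time, in the order of decreasing demand, by
subgraphs whose degrees never exceed the given ones.  If this fails at a vertex `c`, take a subgraph
in which the degree of `c` is maximal.  Edge switches then show that `c` and the vertices saturated
before form a clique, joined to every deficient vertex and to every core vertex with neighbours
among the untreated ones.  In this situation a count of the edges contradicts either the necessary
condition of Erdős and Gallai or the size of the degree sum.
-/

open Finset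

section Degree

variable {V : Type*} {F F' : SimpleGraph V} {X Y : Finset V} {v : V}

open scoped Classical in
/-- The number of neighbours of `v` in the finite set `X`.  Edges between `X` and `Y` are counted
by `∑ x ∈ X, degIn F Y x`.  No decidability instance enters, so the definition applies uniformly
to the graphs that arise from each other by edge switches. -/
noncomputable def degIn (F : SimpleGraph V) (X : Finset V) (v : V) : ℕ := #{w ∈ X | F.Adj v w}

/-- The degree of `v`, as the special case `X = univ` of `degIn`. -/
noncomputable abbrev deg [Fintype V] (F : SimpleGraph V) (v : V) : ℕ := degIn F univ v

theorem degIn_eq_card_filter (F : SimpleGraph V) [DecidableRel F.Adj] (X : Finset V) (v : V) :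
    degIn F X v = #{w ∈ X | F.Adj v w} := by
  unfold degIn; congr

theorem degIn_congr (h : ∀ w ∈ X, F.Adj v w ↔ F'.Adj v w) : degIn F X v = degIn F' X v := by
  classical
  rw [degIn, degIn, filter_congr h]

theorem degIn_mono_left (h : ∀ w ∈ X, F.Adj v w → F'.Adj v w) : degIn F X v ≤ degIn F' X v := by
  classical
  refine card_le_card fun w hw => ?_
  rw [mem_filter] at hw ⊢
  exact ⟨hw.1, h w hw.1 hw.2⟩

theorem degIn_mono (F : SimpleGraph V) (h : X ⊆ Y) (v : V) : degIn F X v ≤ degIn F Y v := by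
  classical exact card_le_card (filter_subset_filter _ h)

theorem degIn_le_card (F : SimpleGraph V) (X : Finset V) (v : V) : degIn F X v ≤ #X := by
  classical exact card_filter_le _ _

theorem degIn_eq_card_iff : degIn F X v = #X ↔ ∀ w ∈ X, F.Adj v w := by
  classical exact card_filter_eq_iff

theorem degIn_eq_zero_iff : degIn F X v = 0 ↔ ∀ w ∈ X, ¬ F.Adj v w := by
  classical exact card_filter_eq_zero_iff

theorem degIn_union [DecidableEq V] (F : SimpleGraph V) (h : Disjoint X Y) (v : V) :
    degIn F (X ∪ Y) v = degIn F X v + degIn F Y v := by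
  classical
  simp only [degIn_eq_card_filter]
  rw [filter_union, card_union_of_disjoint (disjoint_filter_filter h)]

theorem degIn_add_degIn_sdiff [DecidableEq V] (F : SimpleGraph V) (h : X ⊆ Y) (v : V) :
    degIn F X v + degIn F (Y \ X) v = degIn F Y v := by
  rw [← degIn_union F disjoint_sdiff, union_sdiff_of_subset h]

theorem degIn_add_degIn_compl [Fintype V] [DecidableEq V] (F : SimpleGraph V) (X : Finset V)
    (v : V) : degIn F X v + degIn F Xᶜ v = deg F v :=
  degIn_add_degIn_sdiff F (subset_univ X) v

theorem degIn_erase_self [DecidableEq V] (F : SimpleGraph V) (X : Finset V) (v : V) :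
    degIn F (X.erase v) v = degIn F X v := by
  unfold degIn; congr 1; ext w
  simp only [mem_filter, mem_erase]
  exact ⟨fun h => ⟨h.1.2, h.2⟩, fun h => ⟨⟨h.2.ne', h.1⟩, h.2⟩⟩

theorem degIn_le_card_sub_one (F : SimpleGraph V) (hv : v ∈ X) : degIn F X v ≤ #X - 1 := by
  classical
  rw [← degIn_erase_self, ← card_erase_of_mem hv]
  exact degIn_le_card F _ v

theorem degIn_eq_card_sub_one (hv : v ∈ X) (h : ∀ w ∈ X, w ≠ v → F.Adj v w) :
    degIn F X v = #X - 1 := by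
  classical
  rw [← degIn_erase_self, ← card_erase_of_mem hv, degIn_eq_card_iff]
  exact fun w hw => h w (mem_of_mem_erase hw) (ne_of_mem_erase hw)

theorem degIn_sup_of_disjoint (h : Disjoint F F') (X : Finset V) (v : V) :
    degIn (F ⊔ F') X v = degIn F X v + degIn F' X v := by
  classical
  simp only [degIn_eq_card_filter, SimpleGraph.sup_adj]
  rw [filter_or, card_union_of_disjoint]
  rw [disjoint_filter]
  exact fun w _ hF hF' => (disjoint_iff_inf_le.1 h : F ⊓ F' ≤ ⊥) ⟨hF, hF'⟩

theorem sum_degIn_comm (F : SimpleGraph V) (X Y : Finset V) :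
    ∑ x ∈ X, degIn F Y x = ∑ y ∈ Y, degIn F X y := by
  classical
  have h := sum_card_bipartiteAbove_eq_sum_card_bipartiteBelow F.Adj (s := X) (t := Y)
  simpa only [degIn_eq_card_filter, bipartiteAbove, bipartiteBelow, F.adj_comm] using h

theorem sum_degIn_le_mul (F : SimpleGraph V) (X Y : Finset V) :
    ∑ x ∈ X, degIn F Y x ≤ #X * #Y := by
  simpa using sum_le_card_nsmul X _ #Y fun x _ => degIn_le_card F Y x

theorem ncard_neighborSet_eq_deg [Fintype V] (F : SimpleGraph V) (v : V) :
    (F.neighborSet v).ncard = deg F v := by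
  classical
  rw [deg, degIn_eq_card_filter, Set.ncard_eq_toFinset_card']
  congr 1; ext w; simp

theorem even_sum_deg [Fintype V] (F : SimpleGraph V) : Even (∑ v, deg F v) := by
  classical
  have hdeg : ∀ v, deg F v = F.degree v := fun v => by
    rw [← ncard_neighborSet_eq_deg, Set.ncard_eq_toFinset_card']; rfl
  simp only [hdeg, F.sum_degrees_eq_twice_card_edges, even_two_mul]

/-- The necessity half of the Erdős–Gallai theorem, for an arbitrary set of vertices. -/
theorem sum_deg_le [Fintype V] [DecidableEq V] (F : SimpleGraph V) (X : Finset V) :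
    ∑ v ∈ X, deg F v ≤ #X * (#X - 1) + ∑ v ∈ Xᶜ, min #X (deg F v) := by
  simp only [← degIn_add_degIn_compl F X, sum_add_distrib]
  rw [sum_degIn_comm F X Xᶜ]
  gcongr with v
  · simpa using sum_le_card_nsmul X _ (#X - 1) fun v hv => degIn_le_card_sub_one F hv
  · exact le_min (degIn_le_card F X v) (Nat.le_add_right _ _)

theorem edge_adj_of_ne {a b x y : V} (hab : a ≠ b) :
    (SimpleGraph.edge a b).Adj x y ↔ x = a ∧ y = b ∨ x = b ∧ y = a := by
  rw [SimpleGraph.edge_adj, and_iff_left_iff_imp]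
  rintro (⟨rfl, rfl⟩ | ⟨rfl, rfl⟩)
  exacts [hab, hab.symm]

theorem deg_edge [Fintype V] [DecidableEq V] {a b : V} (hab : a ≠ b) (v : V) :
    deg (SimpleGraph.edge a b) v = (Pi.single a 1 : V → ℕ) v + (Pi.single b 1 : V → ℕ) v := by
  rw [deg, degIn_eq_card_filter]
  by_cases hva : v = a
  · subst hva
    simp [edge_adj_of_ne hab, hab, filter_eq']
  · by_cases hvb : v = b
    · subst hvb
      simp [edge_adj_of_ne hab, hva, filter_eq']
    · simp [edge_adj_of_ne hab, hva, hvb]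

theorem deg_sup_edge [Fintype V] [DecidableEq V] {a b : V} (hab : a ≠ b) (h : ¬ F.Adj a b)
    (v : V) : deg (F ⊔ SimpleGraph.edge a b) v =
      deg F v + (Pi.single a 1 : V → ℕ) v + (Pi.single b 1 : V → ℕ) v := by
  rw [deg, degIn_sup_of_disjoint ((SimpleGraph.disjoint_edge F).2 h), add_assoc, ← deg_edge hab]

theorem deg_sdiff_edge [Fintype V] [DecidableEq V] {a b : V} (h : F.Adj a b) (v : V) :
    deg (F \ SimpleGraph.edge a b) v + (Pi.single a 1 : V → ℕ) v + (Pi.single b 1 : V → ℕ) v =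
      deg F v := by
  rw [← deg_sup_edge h.ne (by simp [edge_adj_of_ne h.ne]),
    sdiff_sup_cancel (by simpa [h.ne] using h)]

theorem exists_le_deg_eq [Fintype V] (G : SimpleGraph V) {T B : Finset V} (hdis : Disjoint T B)
    (m : V → ℕ) (hm : ∀ a ∈ T, m a ≤ degIn G B a) :
    ∃ H ≤ G, (∀ x y, H.Adj x y → x ∈ T ∧ y ∈ B ∨ y ∈ T ∧ x ∈ B) ∧ ∀ a ∈ T, deg H a = m a := by
  classical
  have hex : ∀ a, ∃ Y : Finset V, a ∈ T → Y ⊆ {y ∈ B | G.Adj a y} ∧ #Y = m a := fun a => by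
    by_cases ha : a ∈ T
    · obtain ⟨Y, hY⟩ := exists_subset_card_eq (degIn_eq_card_filter G B a ▸ hm a ha)
      exact ⟨Y, fun _ => hY⟩
    · exact ⟨∅, fun h => absurd h ha⟩
  choose Y hY using hex
  have hmem : ∀ a ∈ T, ∀ y ∈ Y a, y ∈ B ∧ G.Adj a y := fun a ha y hy =>
    mem_filter.1 ((hY a ha).1 hy)
  refine ⟨SimpleGraph.fromRel fun x y => x ∈ T ∧ y ∈ Y x, fun x y => ?_, fun x y => ?_,
    fun a ha => ?_⟩
  · rintro ⟨-, h | h⟩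
    exacts [(hmem x h.1 y h.2).2, (hmem y h.1 x h.2).2.symm]
  · rintro ⟨-, h | h⟩
    exacts [Or.inl ⟨h.1, (hmem x h.1 y h.2).1⟩, Or.inr ⟨h.1, (hmem y h.1 x h.2).1⟩]
  · rw [deg, degIn_eq_card_filter, ← (hY a ha).2]
    congr 1
    ext y
    simp only [mem_filter, mem_univ, true_and, SimpleGraph.fromRel_adj]
    refine ⟨fun h => h.2.elim And.right fun h' => ?_, fun h =>
      ⟨(hmem a ha y h).2.ne, Or.inl ⟨ha, h⟩⟩⟩
    exact absurd (hmem y h'.1 a h'.2).1 (disjoint_left.1 hdis ha)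

end Degree

section Switching

variable {V : Type*}

/-- The elementary switch at `x`: the edge `xy` is replaced by `xz`, which moves one unit of degree
from `y` to `z`. -/
def rotateEdge (F : SimpleGraph V) (x y z : V) : SimpleGraph V :=
  F \ SimpleGraph.edge x y ⊔ SimpleGraph.edge x z

variable {Φ F : SimpleGraph V} {a b x y z u v c m : V}

theorem le_sdiff_edge (hle : Φ ≤ F) (hab : ¬ Φ.Adj a b) : Φ ≤ F \ SimpleGraph.edge a b :=
  le_sdiff.2 ⟨hle, (SimpleGraph.disjoint_edge Φ).2 hab⟩

theorem le_rotateEdge (hle : Φ ≤ F) (hxy : ¬ Φ.Adj x y) : Φ ≤ rotateEdge F x y z :=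
  (le_sdiff_edge hle hxy).trans le_sup_left

theorem rotateEdge_adj (hxy : F.Adj x y) (hxz : x ≠ z) :
    (rotateEdge F x y z).Adj u v ↔
      (F.Adj u v ∧ ¬ (u = x ∧ v = y ∨ u = y ∧ v = x)) ∨ u = x ∧ v = z ∨ u = z ∧ v = x := by
  rw [rotateEdge, SimpleGraph.sup_adj, SimpleGraph.sdiff_adj, edge_adj_of_ne hxy.ne,
    edge_adj_of_ne hxz]

variable [Fintype V]

theorem deg_rotateEdge [DecidableEq V] (hxy : F.Adj x y) (hxz : ¬ F.Adj x z) (hne : x ≠ z) (v : V) :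
    deg (rotateEdge F x y z) v + (Pi.single y 1 : V → ℕ) v =
      deg F v + (Pi.single z 1 : V → ℕ) v := by
  have hdel := deg_sdiff_edge hxy v
  have hadd := deg_sup_edge (F := F \ SimpleGraph.edge x y) hne (fun h => hxz h.1) v
  rw [rotateEdge]
  omega

theorem exists_notMem_adj_not_adj (hlt : deg F c < deg F m) {P Q : Finset V}
    (hP : ∀ p ∈ P, F.Adj c p ∧ ¬ F.Adj m p) (hcard : #Q ≤ #P) :
    ∃ w ∉ Q, F.Adj m w ∧ ¬ F.Adj c w := by
  classical
  simp only [deg, degIn_eq_card_filter] at hlt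
  have hsub : P ⊆ ({w | F.Adj c w} : Finset V) := fun p hp => by simpa using (hP p hp).1
  have hPc := card_sdiff_add_card_eq_card hsub
  have hQm := le_card_sdiff Q ({w | F.Adj m w} : Finset V)
  obtain ⟨w, hw, hwP⟩ := exists_mem_notMem_of_card_lt_card
    (show #(({w | F.Adj c w} : Finset V) \ P) < #(({w | F.Adj m w} : Finset V) \ Q) by omega)
  simp only [mem_sdiff, mem_filter, mem_univ, true_and] at hw hwP
  exact ⟨w, hw.2, hw.1, fun hcw => (hP w (by tauto)).2 hw.1⟩

/-- `F` lies between `Φ` and a realization of `d` as far as degrees can tell: it contains the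
forced edges `Φ`, its degrees are at most `d`, and they are equal to `d` on `L`. -/
structure IsSubrealization (d : V → ℕ) (Φ : SimpleGraph V) (L : Finset V) (F : SimpleGraph V) :
    Prop where
  le : Φ ≤ F
  deg_le : ∀ v, deg F v ≤ d v
  deg_eq : ∀ v ∈ L, deg F v = d v

/-- The completion of subrealizations is stuck at `c`: even the subrealization `F` with the largest
possible degree of `c` does not attain `d c`.  Edges outside `L ∪ {c}` are not useful, so they are
assumed absent. -/
structure IsStuck (d : V → ℕ) (Φ : SimpleGraph V) (L : Finset V) (c : V) (F : SimpleGraph V) :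
    Prop extends IsSubrealization d Φ L F where
  even_sum : Even (∑ v, d v)
  notMem : c ∉ L
  deg_lt : deg F c < d c
  deg_max : ∀ F', IsSubrealization d Φ L F' → deg F' c ≤ deg F c
  not_forced : ∀ s ∉ L, ∀ s' ∉ L, ¬ Φ.Adj s s'
  not_adj : ∀ s ∉ L, s ≠ c → ∀ s' ∉ L, s' ≠ c → ¬ F.Adj s s'

/-- The vertex `m` has at least the demand of `c`, and no forced neighbours that `c` lacks; so
every edge of `m` that `c` lacks can be switched away from `m`. -/
def Dominates (d : V → ℕ) (Φ : SimpleGraph V) (c m : V) : Prop :=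
  d c ≤ d m ∧ ∀ w, Φ.Adj m w → Φ.Adj c w

theorem exists_deg_lt_of_eq_add_one {d : V → ℕ} (heven : Even (∑ v, d v))
    (hle : ∀ v, deg F v ≤ d v) (hc : d c = deg F c + 1) : ∃ s, s ≠ c ∧ deg F s < d s := by
  classical
  by_contra! hcon
  have hsum : ∑ v, d v = ∑ v, deg F v + 1 := by
    rw [← add_sum_erase _ _ (mem_univ c), ← add_sum_erase _ (deg F) (mem_univ c),
      sum_congr rfl fun v hv => le_antisymm (hcon v (ne_of_mem_erase hv)) (hle v), hc]
    ring
  rw [hsum, Nat.even_add_one] at heven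
  exact heven (even_sum_deg F)

namespace IsStuck

variable {d : V → ℕ} {F' : SimpleGraph V} {L : Finset V} {m' s x' y' : V}

theorem ne_of_mem (h : IsStuck d Φ L c F) (hx : x ∈ L) : x ≠ c := by
  rintro rfl; exact h.notMem hx

theorem notMem_of_deg_lt (h : IsStuck d Φ L c F) (hs : deg F s < d s) : s ∉ L :=
  fun hL => (h.deg_eq s hL).not_lt hs

theorem false_of_improvement (h : IsStuck d Φ L c F) (hle : Φ ≤ F')
    (hL : ∀ v ∈ L, deg F' v = deg F v) (hdeg : ∀ v, deg F' v ≤ d v) (hc : deg F c < deg F' c) :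
    False :=
  hc.not_ge (h.deg_max F' ⟨hle, hdeg, fun v hv => (hL v hv).trans (h.deg_eq v hv)⟩)

theorem switch (h : IsStuck d Φ L c F) (hle : Φ ≤ F') (hL : ∀ v ∈ L, deg F' v = deg F v)
    (hdeg : ∀ v, deg F' v ≤ d v) (hc : deg F' c = deg F c)
    (hadj : ∀ s ∉ L, s ≠ c → ∀ s' ∉ L, s' ≠ c → ¬ F'.Adj s s') : IsStuck d Φ L c F' where
  le := hle
  deg_le := hdeg
  deg_eq v hv := (hL v hv).trans (h.deg_eq v hv)
  even_sum := h.even_sum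
  notMem := h.notMem
  deg_lt := hc ▸ h.deg_lt
  deg_max F'' h'' := hc ▸ h.deg_max F'' h''
  not_forced := h.not_forced
  not_adj := hadj

theorem false_of_transfer [DecidableEq V] (h : IsStuck d Φ L c F) (hs : s ∉ L) (hsc : s ≠ c)
    (hle : Φ ≤ F') (hdeg : ∀ v, deg F' v + (Pi.single s 1 : V → ℕ) v =
      deg F v + (Pi.single c 1 : V → ℕ) v) : False := by
  have hc : deg F' c = deg F c + 1 := by simpa [hsc.symm] using hdeg c
  have hne : ∀ v ≠ c, deg F' v + (Pi.single s 1 : V → ℕ) v = deg F v := fun v hv => by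
    simpa [hv] using hdeg v
  refine h.false_of_improvement hle (fun v hv => ?_) (fun v => ?_) (by omega)
  · have hvs : v ≠ s := by rintro rfl; exact hs hv
    simpa [hvs] using hne v (h.ne_of_mem hv)
  · rcases eq_or_ne v c with rfl | hv
    · exact hc.trans_le h.deg_lt
    · exact (Nat.le_add_right _ _).trans ((hne v hv).trans_le (h.deg_le v))

theorem false_of_gain [DecidableEq V] (h : IsStuck d Φ L c F) (hsc : s ≠ c) (hs : deg F s < d s)
    (hle : Φ ≤ F') (hdeg : ∀ v, deg F' v =
      deg F v + (Pi.single s 1 : V → ℕ) v + (Pi.single c 1 : V → ℕ) v) : False := by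
  have hc : deg F' c = deg F c + 1 := by simpa [hsc.symm] using hdeg c
  refine h.false_of_improvement hle (fun v hv => ?_) (fun v => ?_) (by omega)
  · have hvs : v ≠ s := by rintro rfl; exact h.notMem_of_deg_lt hs hv
    simpa [hvs, h.ne_of_mem hv] using hdeg v
  · rcases eq_or_ne v c with rfl | hv
    · exact hc.trans_le h.deg_lt
    · rcases eq_or_ne v s with rfl | hvs
      · simpa [hdeg, hv] using hs
      · simpa [hdeg, hv, hvs] using h.deg_le v

theorem adj_of_deg_lt (h : IsStuck d Φ L c F) (hsc : s ≠ c) (hs : deg F s < d s) :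
    F.Adj s c := by
  classical
  by_contra hn
  exact h.false_of_gain hsc hs (h.le.trans le_sup_left) (deg_sup_edge hsc hn)

/-- By parity, a missing single unit of degree at `c` comes with a deficient `s`, necessarily
adjacent to `c`; so if two units can be gained, the second one can be returned at the edge `sc`. -/
theorem false_of_gain_two [DecidableEq V] (h : IsStuck d Φ L c F) (hle : Φ ≤ F')
    (hdeg : ∀ v, deg F' v = deg F v + 2 * (Pi.single c 1 : V → ℕ) v)
    (hadj : ∀ s ∉ L, s ≠ c → F.Adj s c → F'.Adj s c) : False := by
  have hc : deg F' c = deg F c + 2 := by simpa using hdeg c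
  have hne : ∀ v ≠ c, deg F' v = deg F v := fun v hv => by simpa [hv] using hdeg v
  by_cases hone : d c = deg F c + 1
  · obtain ⟨s, hsc, hs⟩ := exists_deg_lt_of_eq_add_one h.even_sum h.deg_le hone
    have hsL := h.notMem_of_deg_lt hs
    refine h.false_of_transfer hsL hsc (le_sdiff_edge hle (h.not_forced s hsL c h.notMem))
      fun v => ?_
    have := deg_sdiff_edge (hadj s hsL hsc (h.adj_of_deg_lt hsc hs)) v
    have := hdeg v
    omega
  · have := h.deg_lt
    refine h.false_of_improvement hle (fun v hv => hne v (h.ne_of_mem hv)) (fun v => ?_) (by omega)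
    rcases eq_or_ne v c with rfl | hv
    · omega
    · exact (hne v hv).trans_le (h.deg_le v)

theorem adj_of_free_adj (h : IsStuck d Φ L c F) (hx : x ∈ L) (hs : s ∉ L) (hsc : s ≠ c)
    (hxs : F.Adj x s) (hfree : ¬ Φ.Adj x s) : F.Adj x c := by
  classical
  by_contra hn
  exact h.false_of_transfer hs hsc (le_rotateEdge h.le hfree)
    (deg_rotateEdge hxs hn (h.ne_of_mem hx))

theorem adj_or_adj_of_free_adj (h : IsStuck d Φ L c F) (hx : x ∈ L) (hy : y ∈ L)
    (hxy : F.Adj x y) (hfree : ¬ Φ.Adj x y) : F.Adj x c ∨ F.Adj y c := by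
  classical
  by_contra! hn
  have hxc := h.ne_of_mem hx
  have hyc := h.ne_of_mem hy
  have hyc' : ¬ (rotateEdge F x y c).Adj y c := by
    rw [rotateEdge_adj hxy hxc]
    have := hxy.ne'
    tauto
  refine h.false_of_gain_two (F' := rotateEdge F x y c ⊔ SimpleGraph.edge y c)
    ((le_rotateEdge h.le hfree).trans le_sup_left) (fun v => ?_) fun s hs _ hadj => ?_
  · have := deg_rotateEdge hxy hn.1 hxc v
    have := deg_sup_edge hyc hyc' v
    omega
  · rw [SimpleGraph.sup_adj, rotateEdge_adj hxy hxc]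
    have hsx : s ≠ x := by rintro rfl; exact hs hx
    have hsy : s ≠ y := by rintro rfl; exact hs hy
    tauto

theorem not_forced_of_dominates (h : IsStuck d Φ L c F) (hm : Dominates d Φ c m)
    (hx : ¬ F.Adj c x) : ¬ Φ.Adj m x :=
  fun hmx => hx (h.le (hm.2 x hmx))

theorem deg_lt_of_dominates (h : IsStuck d Φ L c F) (hmL : m ∈ L) (hm : Dominates d Φ c m) :
    deg F c < deg F m := by
  rw [h.deg_eq m hmL]; exact h.deg_lt.trans_le hm.1

theorem adj_of_dominates (h : IsStuck d Φ L c F) (hmL : m ∈ L) (hm : Dominates d Φ c m) :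
    F.Adj m c := by
  by_contra hn
  obtain ⟨w, -, hmw, hcw⟩ := exists_notMem_adj_not_adj (P := ∅) (Q := ∅)
    (h.deg_lt_of_dominates hmL hm) (by simp) le_rfl
  have hfree := h.not_forced_of_dominates hm hcw
  by_cases hw : w ∈ L
  · exact (h.adj_or_adj_of_free_adj hmL hw hmw hfree).elim hn fun hwc => hcw hwc.symm
  · exact hn (h.adj_of_free_adj hmL hw (by rintro rfl; exact hn hmw) hmw hfree)

/-- The edge `mw` is what a switch can take from `m` and give to `c`. -/
theorem exists_adj_not_adj_of_dominates (h : IsStuck d Φ L c F) (hmL : m ∈ L)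
    (hm : Dominates d Φ c m) : ∃ w ≠ c, F.Adj m w ∧ ¬ F.Adj c w := by
  have hmc := (h.adj_of_dominates hmL hm).symm
  simpa using exists_notMem_adj_not_adj (P := {m}) (Q := {c})
    (h.deg_lt_of_dominates hmL hm) (by simpa using hmc) (by simp)

theorem adj_of_dominates_of_dominates (h : IsStuck d Φ L c F) (hmL : m ∈ L)
    (hm : Dominates d Φ c m) (hmL' : m' ∈ L) (hm' : Dominates d Φ c m') (hne : m ≠ m') :
    F.Adj m m' := by
  classical
  by_contra hn
  have hn' : ¬ F.Adj m' m := fun hadj => hn hadj.symm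
  have hmc := h.adj_of_dominates hmL hm
  have hmc' := h.adj_of_dominates hmL' hm'
  obtain ⟨w, hwc, hmw, hcw⟩ := h.exists_adj_not_adj_of_dominates hmL hm
  obtain ⟨w', hw', hmw', hcw'⟩ := exists_notMem_adj_not_adj (P := {m', m}) (Q := {c, w})
    (h.deg_lt_of_dominates hmL' hm') (by simpa using ⟨hmc'.symm, hmc.symm, hn'⟩)
    (by rw [card_pair hne.symm]; exact card_le_two)
  obtain ⟨hwc', hww⟩ : w' ≠ c ∧ w' ≠ w := by simpa using hw'
  have hwm' : w ≠ m' := by rintro rfl; exact hn hmw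
  have hwm'' : w' ≠ m := by rintro rfl; exact hn' hmw'
  have hw'c : ¬ F.Adj w' c := fun hadj => hcw' hadj.symm
  set F₁ := rotateEdge F m w m'
  have hadj₁ : ∀ {u v}, F₁.Adj u v ↔ _ := rotateEdge_adj hmw hne
  have hwm₁ : F₁.Adj w' m' := by rw [hadj₁]; have := hmw'.symm; tauto
  have hwc₁ : ¬ F₁.Adj w' c := by
    rw [hadj₁]
    have := (h.ne_of_mem hmL).symm
    tauto
  set F₂ := rotateEdge F₁ w' m' c
  have hadj₂ : ∀ {u v}, F₂.Adj u v ↔ _ := rotateEdge_adj hwm₁ hwc'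
  have hwc₂ : ¬ F₂.Adj w c := by
    rw [hadj₂, hadj₁]
    have := fun hadj : F.Adj w c => hcw hadj.symm
    have := (h.ne_of_mem hmL').symm
    tauto
  have hle₁ : Φ ≤ F₁ := le_rotateEdge h.le (h.not_forced_of_dominates hm hcw)
  have hle₂ : Φ ≤ F₂ := le_rotateEdge hle₁ fun hadj =>
    h.not_forced_of_dominates hm' hcw' hadj.symm
  refine h.false_of_gain_two (F' := F₂ ⊔ SimpleGraph.edge w c) (hle₂.trans le_sup_left)
    (fun v => ?_) fun s hs _ hadj => ?_
  · have : deg F₁ v + _ = _ := deg_rotateEdge hmw hn hne v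
    have : deg F₂ v + _ = deg F₁ v + _ := deg_rotateEdge hwm₁ hwc₁ hwc' v
    have := deg_sup_edge hwc hwc₂ v
    omega
  · rw [SimpleGraph.sup_adj, hadj₂, hadj₁]
    have hsm : s ≠ m := by rintro rfl; exact hs hmL
    have hsm' : s ≠ m' := by rintro rfl; exact hs hmL'
    tauto

theorem adj_of_free_adj_of_dominates (h : IsStuck d Φ L c F) (hx : x ∈ L) (hs : s ∉ L)
    (hsc : s ≠ c) (hxs : F.Adj x s) (hfree : ¬ Φ.Adj x s) (hmL : m ∈ L)
    (hm : Dominates d Φ c m) (hne : x ≠ m) : F.Adj x m := by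
  classical
  by_contra hn
  have hxc := h.adj_of_free_adj hx hs hsc hxs hfree
  obtain ⟨w, hwc, hmw, hcw⟩ := h.exists_adj_not_adj_of_dominates hmL hm
  have hwx : w ≠ x := by rintro rfl; exact hcw hxc.symm
  have hadj₁ : ∀ {u v}, (rotateEdge F x s m).Adj u v ↔ _ := rotateEdge_adj hxs hne
  have hwm₁ : (rotateEdge F x s m).Adj w m := by
    rw [hadj₁]
    have := hmw.symm
    tauto
  have hwc₁ : ¬ (rotateEdge F x s m).Adj w c := by
    rw [hadj₁]
    have := fun hadj : F.Adj w c => hcw hadj.symm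
    have := (h.ne_of_mem hx).symm
    have := (h.ne_of_mem hmL).symm
    tauto
  refine h.false_of_transfer hs hsc (F' := rotateEdge (rotateEdge F x s m) w m c)
    (le_rotateEdge (le_rotateEdge h.le hfree)
      fun hadj => h.not_forced_of_dominates hm hcw hadj.symm) fun v => ?_
  have := deg_rotateEdge hxs hn hne v
  have := deg_rotateEdge hwm₁ hwc₁ hwc v
  omega

theorem adj_of_deg_lt_of_dominates (h : IsStuck d Φ L c F) (hsc : s ≠ c) (hs : deg F s < d s)
    (hmL : m ∈ L) (hm : Dominates d Φ c m) : F.Adj s m := by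
  classical
  by_contra hn
  have hsm : s ≠ m := by rintro rfl; exact h.notMem_of_deg_lt hs hmL
  have hcs := (h.adj_of_deg_lt hsc hs).symm
  obtain ⟨w, hwc, hmw, hcw⟩ := h.exists_adj_not_adj_of_dominates hmL hm
  have hws : w ≠ s := by rintro rfl; exact hcw hcs
  have hwc' : ¬ F.Adj w c := fun hadj => hcw hadj.symm
  have hadj₁ : ∀ {u v}, (rotateEdge F w m c).Adj u v ↔ _ := rotateEdge_adj hmw.symm hwc
  have hsm₁ : ¬ (rotateEdge F w m c).Adj s m := by rw [hadj₁]; tauto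
  refine h.false_of_gain hsc hs (F' := rotateEdge F w m c ⊔ SimpleGraph.edge s m)
    ((le_rotateEdge h.le fun hadj => h.not_forced_of_dominates hm hcw hadj.symm).trans
      le_sup_left) fun v => ?_
  have := deg_rotateEdge hmw.symm hwc' hwc v
  have := deg_sup_edge hsm hsm₁ v
  omega

/-- Switching `xy` to `xs` moves the deficiency of `s` to `y`. -/
theorem rotate (h : IsStuck d Φ L c F) (hx : x ∈ L) (hy : y ∉ L) (hyc : y ≠ c) (hsc : s ≠ c)
    (hxy : F.Adj x y) (hfree : ¬ Φ.Adj x y) (hxs : ¬ F.Adj x s) (hs : deg F s < d s) :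
    IsStuck d Φ L c (rotateEdge F x y s) ∧ deg (rotateEdge F x y s) y < d y := by
  classical
  have hsL := h.notMem_of_deg_lt hs
  have hne : x ≠ s := by rintro rfl; exact hsL hx
  have hys : y ≠ s := by rintro rfl; exact hxs hxy
  have hdeg := deg_rotateEdge hxy hxs hne
  refine ⟨h.switch (le_rotateEdge h.le hfree) (fun v hv => ?_) (fun v => ?_) ?_
    fun u hu huc u' hu' huc' => ?_, ?_⟩
  · have hvy : v ≠ y := by rintro rfl; exact hy hv
    have hvs : v ≠ s := by rintro rfl; exact hsL hv
    simpa [hvy, hvs] using hdeg v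
  · rcases eq_or_ne v s with rfl | hvs
    · have : deg (rotateEdge F x y v) v = deg F v + 1 := by simpa [hys.symm] using hdeg v
      omega
    · have : deg (rotateEdge F x y s) v + (Pi.single y 1 : V → ℕ) v = deg F v := by
        simpa [hvs] using hdeg v
      have := h.deg_le v
      omega
  · simpa [hyc.symm, hsc.symm] using hdeg c
  · have := h.not_adj u hu huc u' hu' huc'
    have hux : u ≠ x := by rintro rfl; exact hu hx
    have hux' : u' ≠ x := by rintro rfl; exact hu' hx
    rw [rotateEdge_adj hxy hne]
    tauto
  · have : deg (rotateEdge F x y s) y + 1 = deg F y := by simpa [hys] using hdeg y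
    have := h.deg_le y
    omega

theorem adj_of_free_adj_of_not_adj_deg_lt (h : IsStuck d Φ L c F) (hx : x ∈ L) (hy : y ∉ L)
    (hyc : y ≠ c) (hsc : s ≠ c) (hxy : F.Adj x y) (hfree : ¬ Φ.Adj x y) (hxs : ¬ F.Adj x s)
    (hs : deg F s < d s) : F.Adj y c ∧ ∀ m ∈ L, Dominates d Φ c m → F.Adj y m := by
  obtain ⟨hstuck, hlt⟩ := h.rotate hx hy hyc hsc hxy hfree hxs hs
  have hne : x ≠ s := by rintro rfl; exact h.notMem_of_deg_lt hs hx
  have hof : ∀ m, (rotateEdge F x y s).Adj y m → F.Adj y m := by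
    intro m hm
    rw [rotateEdge_adj hxy hne] at hm
    have := hxy.ne'
    have : y ≠ s := by rintro rfl; exact hxs hxy
    tauto
  exact ⟨hof _ (hstuck.adj_of_deg_lt hyc hlt), fun m hm hdom =>
    hof _ (hstuck.adj_of_deg_lt_of_dominates hyc hlt hm hdom)⟩

/-- Otherwise `y` becomes deficient when the edges `xy` and `x'y'` are replaced by `xx'`. -/
theorem adj_of_free_adj_of_not_adj (h : IsStuck d Φ L c F) (hx : x ∈ L) (hx' : x' ∈ L)
    (hne : x ≠ x') (hxx : ¬ F.Adj x x') (hy : y ∉ L) (hyc : y ≠ c) (hy' : y' ∉ L) (hyc' : y' ≠ c)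
    (hxy : F.Adj x y) (hxy' : F.Adj x' y') (hfree : ¬ Φ.Adj x y) (hfree' : ¬ Φ.Adj x' y') :
    F.Adj y c := by
  classical
  have hyx' : y ≠ x' := by rintro rfl; exact hy hx'
  have hyx := hxy.ne'
  set F₁ := rotateEdge F x y x'
  have hadj₁ : ∀ {u v}, F₁.Adj u v ↔ _ := rotateEdge_adj hxy hne
  have hxy₁ : F₁.Adj x' y' := by rw [hadj₁]; have := hne.symm; tauto
  set F₂ := F₁ \ SimpleGraph.edge x' y'
  have hadj₂ : ∀ {u v}, F₂.Adj u v ↔ _ ∧ ¬ _ := fun {u v} => SimpleGraph.sdiff_adj F₁ _ u v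
  have hdeg : ∀ v,
      deg F₂ v + (Pi.single y 1 : V → ℕ) v + (Pi.single y' 1 : V → ℕ) v = deg F v := by
    intro v
    have : deg F₁ v + _ = _ := deg_rotateEdge hxy hxx hne v
    have : deg F₂ v + _ + _ = deg F₁ v := deg_sdiff_edge hxy₁ v
    omega
  have hstuck : IsStuck d Φ L c F₂ := by
    refine h.switch (le_sdiff_edge (le_rotateEdge h.le hfree) hfree') (fun v hv => ?_)
      (fun v => ?_) ?_ fun u hu huc u' hu' huc' => ?_
    · have hvy : v ≠ y := by rintro rfl; exact hy hv
      have hvy' : v ≠ y' := by rintro rfl; exact hy' hv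
      simpa [hvy, hvy'] using hdeg v
    · have := hdeg v
      have := h.deg_le v
      omega
    · simpa [hyc.symm, hyc'.symm] using hdeg c
    · have := h.not_adj u hu huc u' hu' huc'
      have hux : u ≠ x := by rintro rfl; exact hu hx
      have hux' : u ≠ x' := by rintro rfl; exact hu hx'
      rw [hadj₂, hadj₁]
      tauto
  have hlt : deg F₂ y < d y := by
    have : deg F₂ y + 1 + (Pi.single y' 1 : V → ℕ) y = deg F y := by simpa using hdeg y
    have := h.deg_le y
    omega
  have hyc₂ := hstuck.adj_of_deg_lt hyc hlt
  rw [hadj₂, hadj₁] at hyc₂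
  tauto

end IsStuck

end Switching

section Completion

variable {V : Type*}

/-- The subgraph of `F` formed by the edges with an end in `K`. -/
def edgesMeeting (F : SimpleGraph V) (K : Finset V) : SimpleGraph V where
  Adj x y := F.Adj x y ∧ (x ∈ K ∨ y ∈ K)
  symm := ⟨fun _ _ hxy => ⟨hxy.1.symm, hxy.2.symm⟩⟩
  loopless := ⟨fun _ hx => F.irrefl hx.1⟩

variable [Fintype V] [DecidableEq V] {d : V → ℕ} {Φ F : SimpleGraph V} {L A M : Finset V} {c : V}

theorem IsStuck.false_of_clique (h : IsStuck d Φ L c F) {G : SimpleGraph V}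
    (hG : ∀ v, deg G v = d v) (hclique : ∀ x ∈ insert c L, ∀ y ∈ insert c L, x ≠ y → F.Adj x y)
    (hdef : ∀ s ∉ insert c L, deg F s < d s → ∀ x ∈ insert c L, F.Adj s x) : False := by
  set K := insert c L with hK
  have hlt : ∑ v ∈ K, deg F v < ∑ v ∈ K, d v :=
    sum_lt_sum (fun v _ => h.deg_le v) ⟨c, mem_insert_self _ _, h.deg_lt⟩
  have hgraphic : ∑ v ∈ K, d v ≤ #K * (#K - 1) + ∑ v ∈ Kᶜ, min #K (d v) := by
    simpa only [hG] using sum_deg_le G K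
  have hsum : ∑ v ∈ K, deg F v = #K * (#K - 1) + ∑ s ∈ Kᶜ, degIn F K s := by
    simp only [← degIn_add_degIn_compl F K, sum_add_distrib]
    rw [sum_degIn_comm F K Kᶜ, sum_congr rfl fun v hv =>
      degIn_eq_card_sub_one hv fun w hw hwv => hclique v hv w hw hwv.symm, sum_const, smul_eq_mul]
  have hmin : ∀ s ∈ Kᶜ, min #K (d s) ≤ degIn F K s := fun s hs => by
    rw [mem_compl] at hs
    by_cases hsd : deg F s < d s
    · rw [degIn_eq_card_iff.2 (hdef s hs hsd)]
      exact min_le_left _ _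
    · have hrest : degIn F Kᶜ s = 0 := degIn_eq_zero_iff.2 fun w hw => by
        rw [mem_compl] at hw
        rw [hK, mem_insert, not_or] at hs hw
        exact h.not_adj s hs.2 hs.1 w hw.2 hw.1
      have := degIn_add_degIn_compl F K s
      exact (min_le_right _ _).trans (by omega)
  have := sum_le_sum hmin
  omega

theorem IsSubrealization.exists_insert_or_isStuck (hF : IsSubrealization d Φ L F) (hc : c ∉ L)
    (heven : Even (∑ v, d v)) (hforced : ∀ s ∉ L, ∀ s' ∉ L, ¬ Φ.Adj s s') :
    (∃ F', IsSubrealization d Φ (insert c L) F') ∨ ∃ F', IsStuck d Φ L c F' := by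
  obtain ⟨F₁, hF₁, hmax⟩ := Set.exists_max_image {F | IsSubrealization d Φ L F}
    (fun F => deg F c) (Set.toFinite _) ⟨F, hF⟩
  by_cases hc₁ : deg F₁ c = d c
  · exact Or.inl ⟨F₁, hF₁.le, hF₁.deg_le, (forall_mem_insert c L _).2 ⟨hc₁, hF₁.deg_eq⟩⟩
  · right
    have hdeg : ∀ v ∈ insert c L, deg (edgesMeeting F₁ (insert c L)) v = deg F₁ v := fun v hv =>
      degIn_congr fun w _ => and_iff_left (Or.inl hv)
    have hcc := hdeg c (mem_insert_self _ _)
    refine ⟨edgesMeeting F₁ (insert c L),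
      ⟨⟨fun x y hxy => ⟨hF₁.le hxy, ?_⟩, fun v => ?_, fun v hv => ?_⟩, heven, hc, ?_,
        fun F' hF' => ?_, hforced, fun s hs hsc s' hs' hsc' hadj => ?_⟩⟩
    · by_contra! hn
      exact hforced x (fun hx => hn.1 (mem_insert_of_mem hx)) y
        (fun hy => hn.2 (mem_insert_of_mem hy)) hxy
    · exact (degIn_mono_left (F := edgesMeeting F₁ (insert c L)) (F' := F₁)
        fun w _ hvw => hvw.1).trans (hF₁.deg_le v)
    · rw [hdeg v (mem_insert_of_mem hv), hF₁.deg_eq v hv]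
    · rw [hcc]
      exact (hF₁.deg_le c).lt_of_ne hc₁
    · rw [hcc]
      exact hmax F' hF'
    · have := hadj.2
      simp only [mem_insert] at this
      tauto

/-- The vertices outside `A` are saturated in the order of decreasing demand. -/
theorem IsSubrealization.exists_realization (hF : IsSubrealization d Φ A F)
    (heven : Even (∑ v, d v)) (hforced : ∀ s ∉ A, ∀ s' ∉ A, ¬ Φ.Adj s s')
    (hstuck : ∀ M c F, Disjoint A M → (∀ m ∈ M, d c ≤ d m) →
      (∀ s, s ∉ A → s ∉ M → d s ≤ d c) → IsStuck d Φ (A ∪ M) c F → False) :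
    ∃ G, Φ ≤ G ∧ ∀ v, deg G v = d v := by
  suffices key : ∀ k M F, #(A ∪ M)ᶜ = k → Disjoint A M → IsSubrealization d Φ (A ∪ M) F →
      (∀ m ∈ M, ∀ s, s ∉ A → s ∉ M → d s ≤ d m) → ∃ G, Φ ≤ G ∧ ∀ v, deg G v = d v from
    key _ ∅ F rfl (disjoint_empty_right A) (by rwa [union_empty]) (by simp)
  intro k
  induction k with
  | zero =>
    intro M F hk _ hF _
    rw [card_eq_zero, compl_eq_empty_iff] at hk
    exact ⟨F, hF.le, fun v => hF.deg_eq v (hk ▸ mem_univ v)⟩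
  | succ k ih =>
    intro M F hk hdis hF htop
    obtain ⟨c, hc, hmax⟩ := exists_max_image (A ∪ M)ᶜ d (card_pos.1 (by omega))
    obtain ⟨hcA, hcM⟩ : c ∉ A ∧ c ∉ M := by simpa using hc
    have hmax' : ∀ s, s ∉ A → s ∉ M → d s ≤ d c := fun s hsA hsM => hmax s (by simp [hsA, hsM])
    rcases hF.exists_insert_or_isStuck (mem_compl.1 hc) heven fun s hs s' hs' =>
      hforced s (fun h => hs (mem_union_left _ h)) s' (fun h => hs' (mem_union_left _ h))
      with ⟨F', hF'⟩ | ⟨F', hF'⟩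
    · refine ih (insert c M) F' ?_ (disjoint_insert_right.2 ⟨hcA, hdis⟩) ?_
        fun m hm s hsA hsM => ?_
      · rw [union_insert, compl_insert, card_erase_of_mem hc, hk, Nat.add_sub_cancel]
      · rwa [union_insert]
      · rw [mem_insert, not_or] at hsM
        rcases mem_insert.1 hm with rfl | hm
        exacts [hmax' s hsA hsM.2, htop m hm s hsA hsM.2]
    · exact (hstuck M c F' hdis (fun m hm => htop m hm c hcA hcM) hmax' hF').elim

end Completion

section Obstruction

variable {V : Type*} [Fintype V] [DecidableEq V]

/-- The shape of a stuck graph: `A` is the core, `X ⊆ A` consists of its vertices with neighbours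
in the rest `S`, and `D` is the set of vertices treated so far, the last of which, `c`, is
deficient. -/
structure Obstruction (d : V → ℕ) (F : SimpleGraph V) (A X D S : Finset V) (c : V) : Prop where
  mem : c ∈ D
  subset : X ⊆ A
  disjoint : Disjoint A D
  rest_eq : S = (A ∪ D)ᶜ
  deg_le : ∀ v, deg F v ≤ d v
  deg_core : ∀ v ∈ A, deg F v = d v
  deg_treated : ∀ v ∈ D, v ≠ c → deg F v = d v
  deg_lt : deg F c < d c
  exists_adj : ∀ a ∈ X, ∃ s ∈ S, F.Adj a s
  not_adj_inner : ∀ a ∈ A \ X, ∀ s ∈ S, ¬ F.Adj a s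
  adj_treated : ∀ a ∈ X, ∀ b ∈ D, F.Adj a b
  clique : ∀ b ∈ D, ∀ b' ∈ D, b ≠ b' → F.Adj b b'
  adj_of_deg_lt : ∀ s ∈ S, deg F s < d s → ∀ b ∈ D, F.Adj s b
  not_adj_rest : ∀ s ∈ S, ∀ s' ∈ S, ¬ F.Adj s s'
  even_sum : Even (∑ v, d v)

variable {d : V → ℕ} {Φ F : SimpleGraph V} {A X D S M : Finset V} {a b c v : V}

theorem IsStuck.exists_obstruction (h : IsStuck d Φ (A ∪ M) c F) (hdis : Disjoint A M)
    (hM : ∀ m ∈ M, d c ≤ d m) (hΦ : ∀ x y, Φ.Adj x y → x ∈ A) :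
    ∃ X, Obstruction d F A X (insert c M) (A ∪ insert c M)ᶜ c := by
  classical
  have hdom : ∀ m ∈ M, Dominates d Φ c m := fun m hm =>
    ⟨hM m hm, fun w hw => absurd (hΦ m w hw) (disjoint_right.1 hdis hm)⟩
  have hcA : c ∉ A := fun hc => h.notMem (mem_union_left _ hc)
  have hS : ∀ s ∈ (A ∪ insert c M)ᶜ, s ∉ A ∪ M ∧ s ≠ c := fun s => by
    simp only [mem_compl, mem_union, mem_insert]; tauto
  have hfree : ∀ x, ∀ s ∈ (A ∪ insert c M)ᶜ, ¬ Φ.Adj x s := fun x s hs hadj =>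
    (hS s hs).1 (mem_union_left _ (hΦ _ _ hadj.symm))
  refine ⟨{a ∈ A | ∃ s ∈ (A ∪ insert c M)ᶜ, F.Adj a s},
    { mem := mem_insert_self _ _
      subset := filter_subset _ _
      disjoint := disjoint_insert_right.2 ⟨hcA, hdis⟩
      rest_eq := rfl
      deg_le := h.deg_le
      deg_core := fun v hv => h.deg_eq v (mem_union_left _ hv)
      deg_treated := fun v hv hvc =>
        h.deg_eq v (mem_union_right _ (mem_of_mem_insert_of_ne hv hvc))
      deg_lt := h.deg_lt
      exists_adj := fun a ha => (mem_filter.1 ha).2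
      not_adj_inner := fun a ha s hs hadj =>
        (mem_sdiff.1 ha).2 (mem_filter.2 ⟨(mem_sdiff.1 ha).1, s, hs, hadj⟩)
      adj_treated := fun a ha => ?_
      clique := fun b hb b' hb' hne => ?_
      adj_of_deg_lt := fun s hs hsd => ?_
      not_adj_rest := fun s hs s' hs' =>
        h.not_adj s (hS s hs).1 (hS s hs).2 s' (hS s' hs').1 (hS s' hs').2
      even_sum := h.even_sum }⟩
  · obtain ⟨haA, s, hs, hadj⟩ := mem_filter.1 ha
    have haL := mem_union_left M haA
    refine (forall_mem_insert c M _).2 ⟨?_, fun b hb => ?_⟩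
    · exact h.adj_of_free_adj haL (hS s hs).1 (hS s hs).2 hadj (hfree a s hs)
    · exact h.adj_of_free_adj_of_dominates haL (hS s hs).1 (hS s hs).2 hadj (hfree a s hs)
        (mem_union_right _ hb) (hdom b hb) (by rintro rfl; exact disjoint_left.1 hdis haA hb)
  · have hbc : ∀ m ∈ M, F.Adj m c := fun m hm =>
      h.adj_of_dominates (mem_union_right _ hm) (hdom m hm)
    rcases mem_insert.1 hb with rfl | hbM <;> rcases mem_insert.1 hb' with rfl | hbM'
    · exact absurd rfl hne
    · exact (hbc b' hbM').symm
    · exact hbc b hbM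
    · exact h.adj_of_dominates_of_dominates (mem_union_right _ hbM) (hdom _ hbM)
        (mem_union_right _ hbM') (hdom _ hbM') hne
  · refine (forall_mem_insert c M _).2 ⟨h.adj_of_deg_lt (hS s hs).2 hsd, fun b hb => ?_⟩
    exact h.adj_of_deg_lt_of_dominates (hS s hs).2 hsd (mem_union_right _ hb) (hdom _ hb)

namespace Obstruction

theorem sum_eq (h : Obstruction d F A X D S c) (f : V → ℕ) :
    ∑ v, f v = ∑ v ∈ A, f v + ∑ v ∈ D, f v + ∑ v ∈ S, f v := by
  rw [← sum_union h.disjoint, h.rest_eq, sum_add_sum_compl]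

theorem sum_core_eq (h : Obstruction d F A X D S c) (f : V → ℕ) :
    ∑ v ∈ A, f v = ∑ v ∈ X, f v + ∑ v ∈ A \ X, f v := by
  rw [add_comm, sum_sdiff h.subset]

theorem card_eq (h : Obstruction d F A X D S c) : #A + #D + #S = Fintype.card V := by
  simpa using (h.sum_eq 1).symm

theorem one_le_card_treated (h : Obstruction d F A X D S c) : 1 ≤ #D :=
  card_pos.2 ⟨c, h.mem⟩

theorem deg_eq (h : Obstruction d F A X D S c) (v : V) :
    deg F v = degIn F A v + degIn F D v + degIn F S v := by
  rw [← degIn_union F h.disjoint, h.rest_eq, degIn_add_degIn_compl]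

theorem demand_inner_eq (h : Obstruction d F A X D S c) (ha : a ∈ A \ X) :
    d a = degIn F A a + degIn F D a := by
  rw [← h.deg_core a (sdiff_subset ha), h.deg_eq, degIn_eq_zero_iff.2 (h.not_adj_inner a ha),
    add_zero]

theorem demand_inner_le (h : Obstruction d F A X D S c) (ha : a ∈ A \ X) :
    d a ≤ #A - 1 + #D := by
  rw [h.demand_inner_eq ha]
  exact add_le_add (degIn_le_card_sub_one F (sdiff_subset ha)) (degIn_le_card F D a)

theorem deg_treated_eq (h : Obstruction d F A X D S c) (hb : b ∈ D) :
    deg F b = #D - 1 + #X + degIn F (A \ X) b + degIn F S b := by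
  rw [h.deg_eq, ← degIn_add_degIn_sdiff F h.subset,
    degIn_eq_card_iff.2 fun a ha => (h.adj_treated a ha b hb).symm,
    degIn_eq_card_sub_one hb fun b' hb' hne => h.clique b hb b' hb' hne.symm]
  ring

theorem deg_rest_eq (h : Obstruction d F A X D S c) {s : V} (hs : s ∈ S) :
    deg F s = degIn F X s + degIn F D s := by
  rw [h.deg_eq, ← degIn_add_degIn_sdiff F h.subset, degIn_eq_zero_iff.2 (h.not_adj_rest s hs),
    degIn_eq_zero_iff.2 fun a ha hadj => h.not_adj_inner a ha s hs hadj.symm]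
  rfl

theorem sum_treated_eq (h : Obstruction d F A X D S c) :
    ∑ b ∈ D, d b = #D * (#D - 1) + #D * #X + ∑ a ∈ A \ X, degIn F D a + ∑ b ∈ D, degIn F S b +
      (d c - deg F c) := by
  have hdeg : ∑ b ∈ D, d b = ∑ b ∈ D, deg F b + (d c - deg F c) := by
    have herase : ∑ b ∈ D.erase c, deg F b = ∑ b ∈ D.erase c, d b := sum_congr rfl fun b hb =>
      h.deg_treated b (mem_of_mem_erase hb) (ne_of_mem_erase hb)
    rw [← add_sum_erase D d h.mem, ← add_sum_erase D (fun b => deg F b) h.mem, herase]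
    have := h.deg_lt
    omega
  rw [hdeg, sum_congr rfl fun b hb => h.deg_treated_eq hb]
  simp only [sum_add_distrib, sum_const, smul_eq_mul]
  rw [sum_degIn_comm F D (A \ X)]

theorem card_deg_lt_mul_le (h : Obstruction d F A X D S c) :
    #{s ∈ S | deg F s < d s} * #D ≤ ∑ b ∈ D, degIn F S b := by
  rw [sum_degIn_comm, ← smul_eq_mul]
  refine (card_nsmul_le_sum _ _ #D fun s hs => ?_).trans
    (sum_le_sum_of_subset (filter_subset _ S))
  rw [mem_filter] at hs
  exact (degIn_eq_card_iff.2 (h.adj_of_deg_lt s hs.1 hs.2)).ge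

theorem two_le (h : Obstruction d F A X D S c) :
    2 ≤ ∑ b ∈ D, degIn F S b + (d c - deg F c) := by
  have hlt := h.deg_lt
  by_contra! hcon
  obtain ⟨s, hsc, hs⟩ := exists_deg_lt_of_eq_add_one h.even_sum h.deg_le
    (show d c = deg F c + 1 by omega)
  have hsS : s ∈ S := by
    rw [h.rest_eq, mem_compl, mem_union, not_or]
    exact ⟨fun hA => hs.ne (h.deg_core s hA), fun hD => hs.ne (h.deg_treated s hD hsc)⟩
  have hpos : 0 < #{s ∈ S | deg F s < d s} := card_pos.2 ⟨s, mem_filter.2 ⟨hsS, hs⟩⟩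
  have := Nat.mul_le_mul hpos h.one_le_card_treated
  have := h.card_deg_lt_mul_le
  omega

theorem sum_rest_le (h : Obstruction d F A X D S c) {Δ : ℕ} (hΔ : ∀ s ∈ S, d s ≤ Δ) :
    ∑ s ∈ S, d s ≤ ∑ a ∈ X, degIn F S a + ∑ b ∈ D, degIn F S b +
      #{s ∈ S | deg F s < d s} * (Δ - #D) := by
  have hdemand : ∀ s ∈ S, d s ≤ degIn F X s + degIn F D s +
      (if deg F s < d s then 1 else 0) * (Δ - #D) := fun s hs => by
    rw [← h.deg_rest_eq hs]
    split_ifs with hlt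
    · have := h.deg_rest_eq hs
      have := degIn_eq_card_iff.2 (h.adj_of_deg_lt s hs hlt)
      have := hΔ s hs
      omega
    · omega
  refine (sum_le_sum hdemand).trans_eq ?_
  rw [sum_add_distrib, sum_add_distrib, sum_degIn_comm F S X, sum_degIn_comm F S D, ← sum_mul,
    card_filter]

end Obstruction

end Obstruction

section Counting

/-- The bound `(r - 1)(2n - r) - 3(n - r) - 1` of the theorem, without its parity correction. -/
def sumBound (r n : ℕ) : ℤ := (r - 1) * (2 * n - r) - 3 * (n - r) - 1

variable {V : Type*} [Fintype V]

/-- The numerical assumptions of the theorem on a demand `d`. -/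
structure HasLargeSum (r : ℕ) (d : V → ℕ) : Prop where
  six_le : 6 ≤ r
  le_card : 5 * r + 18 ≤ Fintype.card V
  le_sum : sumBound r (Fintype.card V) ≤ ∑ v, (d v : ℤ)

theorem counting_contradiction {r n p q k : ℤ} (hr : 6 ≤ r) (hn : 5 * r + 18 ≤ n) (hk : 0 ≤ k)
    (hk1 : k ≤ 1) (hp : 0 ≤ p) (hpr : p + k + 3 ≤ r) (hq : 1 ≤ q) (hpq : p + q ≤ r)
    (h : (r - 1) * (2 * n - r) - 3 * (n - r) - 1 ≤
      p * (n - 1) + (r + 1 + k - p) * (r + k + q) + q * (r + q - 1) +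
        (p * (n - r - 1 - k - q) + (q * (r + 1 - p - q) - 1) + (r - p - q) * (r - 1))) :
    False := by
  obtain ⟨α, rfl⟩ : ∃ α, p = r + 1 - α := ⟨r + 1 - p, by ring⟩
  have hcard : 0 ≤ (2 * α - 7) * (n - (5 * r + 18)) := by apply mul_nonneg <;> linarith
  have hprod : 0 ≤ (α - 4 - k) * (r + 1 - α) := by apply mul_nonneg <;> linarith
  have hprod' : 0 ≤ (α - 4 - k) * r := by apply mul_nonneg <;> linarith
  obtain rfl | rfl : k = 0 ∨ k = 1 := by omega
  all_goals
    rcases le_total (3 * α) (r + 1) with hα | hα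
    · have : 0 ≤ q * (r + 1 - 3 * α) := by apply mul_nonneg <;> linarith
      linarith
    · have : 0 ≤ (α - 1 - q) * (3 * α - 1 - r) := by apply mul_nonneg <;> linarith
      linarith

end Counting

section SmallReach

variable {V : Type*} [Fintype V] [DecidableEq V] {d : V → ℕ} {Φ F : SimpleGraph V}
  {A X D S M : Finset V} {a c : V}

theorem Obstruction.exists_adj_not_adj (h : Obstruction d F A A D S c) (ha : a ∈ A)
    (hac : d c ≤ d a) : ∃ y ∈ S, F.Adj a y ∧ ¬ F.Adj y c := by
  classical
  by_contra! hcon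
  have hS : degIn F S a ≤ degIn F S c := by
    simp only [degIn_eq_card_filter]
    exact card_le_card fun y hy => by
      rw [mem_filter] at hy ⊢
      exact ⟨hy.1, (hcon y hy.1 hy.2).symm⟩
  have := h.deg_treated_eq h.mem
  have := h.deg_lt
  have := h.deg_core a ha
  have := h.deg_eq a
  have := degIn_le_card_sub_one F ha
  have := degIn_le_card F D a
  have := card_pos.2 ⟨a, ha⟩
  have := h.one_le_card_treated
  omega

/-- If every vertex of the core has a neighbour in the rest, then core and treated vertices form a
clique that refutes the Erdős–Gallai inequality. -/
theorem IsStuck.false_of_obstruction_self (h : IsStuck d Φ (A ∪ M) c F)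
    (hΦ : ∀ x y, Φ.Adj x y → x ∈ A) (hA : ∀ a ∈ A, d c ≤ d a) {G : SimpleGraph V}
    (hG : ∀ v, deg G v = d v) (ho : Obstruction d F A A (insert c M) (A ∪ insert c M)ᶜ c) :
    False := by
  have hS : ∀ s ∈ (A ∪ insert c M)ᶜ, s ∉ A ∪ M ∧ s ≠ c := fun s => by
    simp only [mem_compl, mem_union, mem_insert]; tauto
  have hfree : ∀ x, ∀ s ∈ (A ∪ insert c M)ᶜ, ¬ Φ.Adj x s := fun x s hs hadj =>
    (hS s hs).1 (mem_union_left _ (hΦ _ _ hadj.symm))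
  have hdef : ∀ s ∈ (A ∪ insert c M)ᶜ, deg F s < d s → ∀ a ∈ A, F.Adj s a := by
    intro s hs hsd a ha
    by_contra hn
    obtain ⟨y, hy, hay, hyc⟩ := ho.exists_adj_not_adj ha (hA a ha)
    exact hyc (h.adj_of_free_adj_of_not_adj_deg_lt (mem_union_left _ ha) (hS y hy).1 (hS y hy).2
      (hS s hs).2 hay (hfree a y hy) (fun has => hn has.symm) hsd).1
  have hcore : ∀ a ∈ A, ∀ a' ∈ A, a ≠ a' → F.Adj a a' := by
    intro a ha a' ha' hne
    by_contra hn
    obtain ⟨y, hy, hay, hyc⟩ := ho.exists_adj_not_adj ha (hA a ha)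
    obtain ⟨y', hy', hay'⟩ := ho.exists_adj a' ha'
    exact hyc (h.adj_of_free_adj_of_not_adj (mem_union_left _ ha) (mem_union_left _ ha') hne hn
      (hS y hy).1 (hS y hy).2 (hS y' hy').1 (hS y' hy').2 hay hay' (hfree a y hy)
      (hfree a' y' hy'))
  have hK : insert c (A ∪ M) = A ∪ insert c M := (union_insert c A M).symm
  refine h.false_of_clique hG (fun x hx y hy hne => ?_) (fun s hs hsd x hx => ?_) <;>
    rw [hK, mem_union] at hx
  · rw [hK, mem_union] at hy
    rcases hx with hx | hx <;> rcases hy with hy | hy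
    exacts [hcore x hx y hy hne, ho.adj_treated x hx y hy, (ho.adj_treated y hy x hx).symm,
      ho.clique x hx y hy hne]
  · have hsS := mem_compl.2 (hK ▸ hs)
    exact hx.elim (hdef s hsS hsd x) (ho.adj_of_deg_lt s hsS hsd x)

namespace Obstruction

theorem false_of_card_add_le {r k : ℕ} (h : Obstruction d F A X D S c) (hd : HasLargeSum r d)
    (hk : k ≤ 1) (hA : #A = r + 1 + k) (hX : #X + k + 3 ≤ r) (hsmall : ∀ v ∉ A, d v < r + #D)
    (hE : ∑ b ∈ D, degIn F S b < #D * (r + 1 - (#X + #D))) : False := by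
  set E := ∑ b ∈ D, degIn F S b
  set ν := #{s ∈ S | deg F s < d s}
  have hq := h.one_le_card_treated
  have hν : ν < r + 1 - (#X + #D) := Nat.lt_of_mul_lt_mul_left (a := #D) <| by
    rw [mul_comm]; exact h.card_deg_lt_mul_le.trans_lt hE
  have hinner : #(A \ X) + #X = r + 1 + k := hA ▸ card_sdiff_add_card_eq_card h.subset
  have hcard := h.card_eq
  have hsumX : ∑ v ∈ X, d v ≤ #X * (Fintype.card V - 1) := sum_le_card_nsmul X d _ fun a ha => by
    rw [← h.deg_core a (h.subset ha)]
    exact degIn_le_card_sub_one F (mem_univ a)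
  have hsumI : ∑ v ∈ A \ X, d v ≤ #(A \ X) * (r + k + #D) :=
    sum_le_card_nsmul _ d _ fun a ha => (h.demand_inner_le ha).trans (by omega)
  have hsumD : ∑ v ∈ D, d v ≤ #D * (r + #D - 1) := sum_le_card_nsmul D d _ fun b hb =>
    Nat.le_sub_one_of_lt (hsmall b (disjoint_right.1 h.disjoint hb))
  have hsumS : ∑ v ∈ S, d v ≤ #X * #S + E + ν * (r - 1) := by
    refine (h.sum_rest_le (Δ := r + #D - 1) fun s hs => Nat.le_sub_one_of_lt (hsmall s ?_)).trans ?_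
    · rw [h.rest_eq, mem_compl, mem_union, not_or] at hs
      exact hs.1
    · rw [show r + #D - 1 - #D = r - 1 by omega]
      gcongr
      exact sum_degIn_le_mul F X S
  have hν' : ν * (r - 1) ≤ (r - (#X + #D)) * (r - 1) := Nat.mul_le_mul_right _ (by omega)
  have hsum := hd.le_sum
  have hn := hd.le_card
  have hr := hd.six_le
  rw [← Nat.cast_sum, h.sum_eq, h.sum_core_eq] at hsum
  zify [show 1 ≤ Fintype.card V by omega, show 1 ≤ r by omega, show 1 ≤ r + #D by omega,
    show #X + #D ≤ r + 1 by omega, show #X + #D ≤ r by omega] at *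
  refine counting_contradiction (r := r) (n := Fintype.card V) (p := #X) (q := #D) (k := k)
    (by omega) (by omega) (by omega) (by omega) (by omega) (by omega) (by omega) (by omega) ?_
  rw [show (r : ℤ) + 1 + k - #X = #(A \ X) by omega,
    show (Fintype.card V : ℤ) - r - 1 - k - #D = #S by omega]
  unfold sumBound at hsum
  linarith

theorem false_of_forall_lt {r k : ℕ} (h : Obstruction d F A X D S c) (hd : HasLargeSum r d)
    (hk : k ≤ 1) (hA : #A = r + 1 + k) (hX : #X + k + 3 ≤ r) (hsmall : ∀ v ∉ A, d v < r) :
    False := by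
  refine h.false_of_card_add_le hd hk hA hX (fun v hv => Nat.lt_add_right _ (hsmall v hv)) ?_
  have hsumD : ∑ v ∈ D, d v ≤ #D * (r - 1) := sum_le_card_nsmul D d _ fun b hb =>
    Nat.le_sub_one_of_lt (hsmall b (disjoint_right.1 h.disjoint hb))
  have hq := h.one_le_card_treated
  have htwo := h.two_le
  have heq := h.sum_treated_eq
  have : #D * (#D - 1 + #X) < #D * (r - 1) := by rw [mul_add]; omega
  have hlt := Nat.lt_of_mul_lt_mul_left this
  rw [show r + 1 - (#X + #D) = r - 1 - (#D - 1 + #X) + 1 by omega, mul_add, Nat.mul_sub, mul_add]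
  omega

end Obstruction

end SmallReach

section Core

variable {V : Type*} [DecidableEq V]

/-- The clique on `T`, joined completely to `W`, with the edges of `Γ` inside `W`: the subgraph that
a realization has to contain. -/
def coreGraph (T W : Finset V) (Γ : SimpleGraph V) : SimpleGraph V where
  Adj x y := x ≠ y ∧
    ((x ∈ T ∧ y ∈ T ∪ W) ∨ (y ∈ T ∧ x ∈ T ∪ W) ∨ (x ∈ W ∧ y ∈ W ∧ Γ.Adj x y))
  symm := ⟨fun x y h => ⟨h.1.symm, by have := Γ.adj_comm x y; tauto⟩⟩
  loopless := ⟨fun _ h => h.1 rfl⟩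

variable {d : V → ℕ} {G Γ : SimpleGraph V} {T W B : Finset V} {a w x y : V}

theorem coreGraph_adj_of_ne (hx : x ∈ T) (hy : y ∈ T ∪ W) (hne : x ≠ y) :
    (coreGraph T W Γ).Adj x y := ⟨hne, Or.inl ⟨hx, hy⟩⟩

theorem mem_of_coreGraph_adj (h : (coreGraph T W Γ).Adj x y) : x ∈ T ∪ W := by
  obtain ⟨-, h | h | h⟩ := h
  exacts [mem_union_left _ h.1, h.2, mem_union_right _ h.1]

theorem coreGraph_adj_of_mem_right (hdis : Disjoint T W) (hx : x ∈ W) (hy : y ∈ W) :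
    (coreGraph T W Γ).Adj x y ↔ Γ.Adj x y := by
  have hxT := disjoint_right.1 hdis hx
  have hyT := disjoint_right.1 hdis hy
  have : Γ.Adj x y → x ≠ y := SimpleGraph.Adj.ne
  simp only [coreGraph]
  tauto

variable [Fintype V]

theorem deg_coreGraph_of_notMem (hx : x ∉ T ∪ W) : deg (coreGraph T W Γ) x = 0 :=
  degIn_eq_zero_iff.2 fun _ _ h => hx (mem_of_coreGraph_adj h)

theorem degIn_coreGraph_compl (x : V) : degIn (coreGraph T W Γ) (T ∪ W)ᶜ x = 0 :=
  degIn_eq_zero_iff.2 fun _ hy h => mem_compl.1 hy (mem_of_coreGraph_adj h.symm)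

theorem deg_coreGraph_of_mem_left (hdis : Disjoint T W) (ha : a ∈ T) :
    deg (coreGraph T W Γ) a = #T + #W - 1 := by
  rw [← degIn_add_degIn_compl _ (T ∪ W), degIn_coreGraph_compl, add_zero,
    ← card_union_of_disjoint hdis]
  exact degIn_eq_card_sub_one (mem_union_left _ ha) fun y hy hne =>
    coreGraph_adj_of_ne ha hy hne.symm

theorem deg_coreGraph_of_mem_right (hdis : Disjoint T W) (hw : w ∈ W) :
    deg (coreGraph T W Γ) w = #T + degIn Γ W w := by
  rw [← degIn_add_degIn_compl _ (T ∪ W), degIn_coreGraph_compl, add_zero, degIn_union _ hdis]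
  congr 1
  · refine degIn_eq_card_iff.2 fun a ha => (coreGraph_adj_of_ne ha (mem_union_right _ hw) ?_).symm
    rintro rfl
    exact disjoint_left.1 hdis ha hw
  · exact degIn_congr fun x hx => coreGraph_adj_of_mem_right hdis hw hx

theorem exists_isSubrealization_coreGraph (hG : ∀ v, deg G v = d v) (hdis : Disjoint T W)
    (hT : ∀ a ∈ T, #T + #W ≤ d a + 1) (hW : ∀ w ∈ W, #T + degIn Γ W w ≤ d w) :
    ∃ F, IsSubrealization d (coreGraph T W Γ) T F ∧ ∀ w ∈ W, deg F w = #T + degIn Γ W w := by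
  have hm : ∀ a ∈ T, d a - (#T + #W - 1) ≤ degIn G (T ∪ W)ᶜ a := fun a ha => by
    have := degIn_le_card_sub_one G (mem_union_left W ha)
    rw [← hG a, ← degIn_add_degIn_compl G (T ∪ W), ← card_union_of_disjoint hdis]
    omega
  obtain ⟨H, hHG, hH, hHT⟩ := exists_le_deg_eq G
    (disjoint_compl_right.mono_left subset_union_left) (fun a => d a - (#T + #W - 1)) hm
  have hHW : ∀ w ∈ W, deg H w = 0 := fun w hw => degIn_eq_zero_iff.2 fun x _ hwx => by
    rcases hH w x hwx with h | h
    · exact disjoint_left.1 hdis h.1 hw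
    · exact mem_compl.1 h.2 (mem_union_right _ hw)
  have hadd : ∀ v, deg (coreGraph T W Γ ⊔ H) v = deg (coreGraph T W Γ) v + deg H v := fun v =>
    degIn_sup_of_disjoint (SimpleGraph.disjoint_left.2 fun x y hxy hxy' => by
      rcases hH x y hxy' with h | h
      · exact mem_compl.1 h.2 (mem_of_coreGraph_adj hxy.symm)
      · exact mem_compl.1 h.2 (mem_of_coreGraph_adj hxy)) _ v
  have hFT : ∀ a ∈ T, deg (coreGraph T W Γ ⊔ H) a = d a := fun a ha => by
    have := hT a ha
    rw [hadd, deg_coreGraph_of_mem_left hdis ha, hHT a ha]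
    omega
  have hFW : ∀ w ∈ W, deg (coreGraph T W Γ ⊔ H) w = #T + degIn Γ W w := fun w hw => by
    rw [hadd, deg_coreGraph_of_mem_right hdis hw, hHW w hw, add_zero]
  refine ⟨_, ⟨le_sup_left, fun v => ?_, hFT⟩, hFW⟩
  by_cases hvT : v ∈ T
  · exact (hFT v hvT).le
  by_cases hvW : v ∈ W
  · exact (hFW v hvW).trans_le (hW v hvW)
  · rw [hadd, deg_coreGraph_of_notMem (by simp [hvT, hvW]), zero_add, ← hG v]
    exact degIn_mono_left fun w _ h => hHG h

theorem exists_realization_coreGraph_of_deg_eq {r k : ℕ} (hG : ∀ v, deg G v = d v)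
    (hd : HasLargeSum r d) (hdis : Disjoint T W) (hk : k ≤ 1) (hcard : #T + #W = r + 1 + k)
    (hT : #T + k + 3 ≤ r) (hle : ∀ a ∈ T, r + k ≤ d a) (hW : ∀ w ∈ W, d w = #T + degIn Γ W w)
    (hsmall : ∀ v ∉ T ∪ W, d v < r) :
    ∃ G', coreGraph T W Γ ≤ G' ∧ ∀ v, deg G' v = d v := by
  obtain ⟨F, hF, hFW⟩ := exists_isSubrealization_coreGraph hG hdis
    (fun a ha => by have := hle a ha; omega) fun w hw => (hW w hw).ge
  have hF' : IsSubrealization d (coreGraph T W Γ) (T ∪ W) F :=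
    ⟨hF.le, hF.deg_le, fun v hv => (mem_union.1 hv).elim (hF.deg_eq v) fun hw =>
      (hFW v hw).trans (hW v hw).symm⟩
  have heven : Even (∑ v, d v) := by simpa only [hG] using even_sum_deg G
  refine hF'.exists_realization heven (fun s hs _ _ h => hs (mem_of_coreGraph_adj h)) ?_
  intro M c F' hdisM hM _ hst
  obtain ⟨X, ho⟩ := hst.exists_obstruction hdisM hM fun x y h => mem_of_coreGraph_adj h
  have hX : X ⊆ T := fun x hx => by
    by_contra hxT
    have hxW : x ∈ W := (mem_union.1 (ho.subset hx)).resolve_left hxT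
    obtain ⟨s, hs, hadj⟩ := ho.exists_adj x hx
    have hsA : s ∈ (T ∪ W)ᶜ := by
      rw [ho.rest_eq, mem_compl, mem_union, not_or] at hs
      exact mem_compl.2 hs.1
    have hcore : degIn (coreGraph T W Γ) (T ∪ W) x = d x := by
      rw [hW x hxW, ← deg_coreGraph_of_mem_right hdis hxW,
        ← degIn_add_degIn_compl _ (T ∪ W), degIn_coreGraph_compl, add_zero]
    have hle : degIn (coreGraph T W Γ) (T ∪ W) x ≤ degIn F' (T ∪ W) x :=
      degIn_mono_left fun w _ h => hst.le h
    have hsplit := degIn_add_degIn_compl F' (T ∪ W) x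
    have hdeg : deg F' x = d x := ho.deg_core x (ho.subset hx)
    exact degIn_eq_zero_iff.1 (by omega : degIn F' (T ∪ W)ᶜ x = 0) s hsA hadj
  have hXT := card_le_card hX
  exact ho.false_of_forall_lt hd hk (card_union_of_disjoint hdis ▸ hcard) (by omega) hsmall

end Core

section JoinCore

theorem inner_bounds {q α Δ r p K e : ℤ} (hq : 1 ≤ q) (hα : 1 ≤ α) (hp : p + α = r + 1)
    (hK : 2 ≤ K) (he : 0 ≤ e) (heα : α * (Δ - r) ≤ e) (hΔ : Δ ≤ r + q)
    (h : q * (q - 1) + q * p + e + K ≤ q * Δ) :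
    q < α ∧ Δ < r + q ∧ K ≤ q * (α - q) ∧ (α ≤ 3 → α = 3 ∧ Δ = r ∧ e = 0) := by
  obtain rfl : p = r + 1 - α := by linarith
  have hprod : K ≤ (α - q) * (r + q - Δ) := by linarith
  have hprod' : K ≤ q * (Δ - r + α - q) := by linarith
  obtain ⟨hpos, hpos'⟩ : 0 < α - q ∧ 0 < r + q - Δ :=
    (pos_and_pos_or_neg_and_neg_of_mul_pos (by linarith)).resolve_right fun hneg => by
      linarith [hneg.2]
  have hKq : K ≤ q * (α - q) := by
    rcases le_total r Δ with hr | hr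
    · exact hprod.trans (by rw [mul_comm q]; gcongr; linarith)
    · exact hprod'.trans (by gcongr; linarith)
  refine ⟨by linarith, by linarith, hKq, fun hα3 => ?_⟩
  have hcases : α = 2 ∧ q = 1 ∨ α = 3 ∧ q = 1 ∨ α = 3 ∧ q = 2 := by omega
  obtain ⟨rfl, rfl⟩ | ⟨rfl, rfl⟩ | ⟨rfl, rfl⟩ := hcases <;> omega

variable {V : Type*} [DecidableEq V] {d : V → ℕ} {F G : SimpleGraph V}
  {T W A X D S M : Finset V} {a c w : V} {r : ℕ}

/-- The core `K_{r-2} ∨ 3K_1`, placed on the largest demands: `T` carries the clique and `W` the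
three independent vertices. -/
structure IsJoinCore (r : ℕ) (d : V → ℕ) (T W : Finset V) : Prop where
  disjoint : Disjoint T W
  card_left : #T + 2 = r
  card_right : #W = 3
  le_left : ∀ a ∈ T, ∀ w ∈ W, d w ≤ d a
  le_right : ∀ w ∈ W, ∀ b ∉ T ∪ W, d b ≤ d w

theorem IsJoinCore.card_union (hJ : IsJoinCore r d T W) : #(T ∪ W) = r + 1 := by
  rw [card_union_of_disjoint hJ.disjoint, hJ.card_right, ← hJ.card_left]

theorem IsJoinCore.le_of_notMem (hJ : IsJoinCore r d T W) {b : V} (ha : a ∈ T ∪ W)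
    (hb : b ∉ T ∪ W) : d b ≤ d a := by
  rcases mem_union.1 ha with haT | haW
  · obtain ⟨w, hw⟩ := card_pos.1 (by rw [hJ.card_right]; norm_num : 0 < #W)
    exact (hJ.le_right w hw b hb).trans (hJ.le_left a haT w hw)
  · exact hJ.le_right a haW b hb

variable [Fintype V]

namespace Obstruction

theorem inner_bounds_of_le (h : Obstruction d F A X D S c) (hA : #A = r + 1)
    (hI : (A \ X).Nonempty) {Δ : ℕ} (hD : ∀ b ∈ D, d b ≤ Δ) (hAΔ : ∀ a ∈ A, Δ ≤ d a) :
    Δ < r + #D ∧ ∑ b ∈ D, degIn F S b + (d c - deg F c) ≤ #D * (#(A \ X) - #D) ∧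
      (#(A \ X) ≤ 3 → #(A \ X) = 3 ∧ Δ = r ∧ ∑ a ∈ A \ X, degIn F D a = 0) := by
  obtain ⟨a, ha⟩ := hI
  have hq := h.one_le_card_treated
  have hcard := card_sdiff_add_card_eq_card h.subset
  have hinner : #(A \ X) * Δ ≤ ∑ a ∈ A \ X, degIn F D a + #(A \ X) * r := by
    rw [← smul_eq_mul #(A \ X) r, ← sum_const, ← sum_add_distrib]
    refine card_nsmul_le_sum _ _ Δ fun a ha => (hAΔ a (sdiff_subset ha)).trans ?_
    have := degIn_le_card_sub_one F (sdiff_subset ha)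
    rw [h.demand_inner_eq ha]
    omega
  have hΔ := (hAΔ a (sdiff_subset ha)).trans (h.demand_inner_le ha)
  have hsum := h.sum_treated_eq ▸ sum_le_card_nsmul D d Δ hD
  obtain ⟨hDI, hlt, hK, htight⟩ := inner_bounds (q := #D) (α := #(A \ X)) (Δ := Δ) (r := r)
    (p := #X) (K := (∑ b ∈ D, degIn F S b + (d c - deg F c) : ℕ))
    (e := (∑ a ∈ A \ X, degIn F D a : ℕ))
    (by omega) (by exact_mod_cast card_pos.2 ⟨a, ha⟩) (by omega) (by exact_mod_cast h.two_le)
    (by omega) (by zify at hinner ⊢; linarith) (by omega)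
    (by rw [smul_eq_mul] at hsum; zify [hq] at hsum ⊢; linarith)
  exact ⟨by omega, by zify [show #D ≤ #(A \ X) by omega] at hK ⊢; exact hK, fun hI3 => by
    obtain ⟨hα_eq, hΔ_eq, he_eq⟩ := htight (by omega)
    exact ⟨by omega, by omega, by omega⟩⟩

theorem inner_of_sum_eq_zero (h : Obstruction d F A X D S c) (hA : #A = r + 1)
    (he : ∑ a ∈ A \ X, degIn F D a = 0) (ha : a ∈ A \ X) (hr : r ≤ d a) :
    (∀ b ∈ D, ¬ F.Adj a b) ∧ d a = r ∧ ∀ x ∈ A, x ≠ a → F.Adj a x := by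
  have hD := sum_eq_zero_iff.1 he a ha
  have hda := h.demand_inner_eq ha
  have hle := degIn_le_card_sub_one F (sdiff_subset ha)
  have hall : degIn F (A.erase a) a = #(A.erase a) := by
    rw [degIn_erase_self, card_erase_of_mem (sdiff_subset ha)]
    omega
  exact ⟨degIn_eq_zero_iff.1 hD, by omega, fun x hx hne =>
    degIn_eq_card_iff.1 hall x (mem_erase.2 ⟨hne, hx⟩)⟩

theorem right_of_demand_le (h : Obstruction d F (T ∪ W) X D S c) (hdis : Disjoint T W)
    (hT : ∀ a ∈ T, F.Adj w a) (hwX : w ∈ X) (hw : d w ≤ #T + 2) :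
    #D = 1 ∧ degIn F S w = 1 ∧ degIn F W w = 0 := by
  obtain ⟨s, hs, hadj⟩ := h.exists_adj w hwX
  have hS : degIn F S w ≠ 0 := fun h0 => degIn_eq_zero_iff.1 h0 s hs hadj
  have hD := h.one_le_card_treated
  have hdeg := h.deg_eq w
  rw [h.deg_core w (h.subset hwX), degIn_union F hdis, degIn_eq_card_iff.2 hT,
    degIn_eq_card_iff.2 (h.adj_treated w hwX)] at hdeg
  omega

theorem false_of_card_treated_eq_one (h : Obstruction d F A X D S c) (hd : HasLargeSum r d)
    (hW : W ⊆ X) (hWcard : #W = 3) (hI : #(A \ X) = 3) (hX : #X + 2 = r) (hD : #D = 1)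
    (hdr : ∀ v ∉ X \ W, d v ≤ r) (hWS : ∀ w ∈ W, degIn F S w = 1)
    (hE : ∑ b ∈ D, degIn F S b ≤ 1) : False := by
  have hsplit : ∀ f : V → ℕ, ∑ v ∈ X, f v = ∑ v ∈ X \ W, f v + ∑ v ∈ W, f v :=
    fun f => (sum_sdiff hW).symm
  have hbound : ∀ Y : Finset V, Disjoint Y (X \ W) → ∑ v ∈ Y, d v ≤ #Y * r := fun Y hY =>
    sum_le_card_nsmul Y d _ fun v hv => hdr v (disjoint_left.1 hY hv)
  have hsumW := hbound W disjoint_sdiff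
  have hsumI := hbound (A \ X) (disjoint_sdiff_self_left.mono_right sdiff_subset)
  have hsumD := hbound D (h.disjoint.symm.mono_right (sdiff_subset.trans h.subset))
  have hsumX : ∑ v ∈ X \ W, d v ≤ #(X \ W) * (Fintype.card V - 1) :=
    sum_le_card_nsmul _ d _ fun a ha => by
      rw [← h.deg_core a (h.subset (sdiff_subset ha))]
      exact degIn_le_card_sub_one F (mem_univ a)
  have hsumS := h.sum_rest_le (Δ := r) fun s hs => hdr s fun hsX => by
    rw [h.rest_eq, mem_compl, mem_union, not_or] at hs
    exact hs.1 (h.subset (sdiff_subset hsX))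
  have hWSsum : ∑ w ∈ W, degIn F S w = 3 := by rw [sum_congr rfl hWS, sum_const, hWcard]; rfl
  have hXSsum := sum_degIn_le_mul F (X \ W) S
  have hdef := h.card_deg_lt_mul_le
  rw [hD, mul_one] at hdef
  have hdef' : #{s ∈ S | deg F s < d s} * (r - #D) ≤ 1 * r :=
    Nat.mul_le_mul (hdef.trans hE) (Nat.sub_le _ _)
  have hcore : #(X \ W) + 3 = #X := hWcard ▸ card_sdiff_add_card_eq_card hW
  have hinner : 3 + #X = #A := hI ▸ card_sdiff_add_card_eq_card h.subset
  have hcard := h.card_eq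
  have hsum := hd.le_sum
  have hn := hd.le_card
  have hr := hd.six_le
  rw [hsplit] at hsumS
  rw [hWcard] at hsumW
  rw [hI] at hsumI
  rw [hD, one_mul] at hsumD
  rw [← Nat.cast_sum, h.sum_eq, h.sum_core_eq, hsplit] at hsum
  have hle : ∑ v ∈ X \ W, d v + ∑ v ∈ W, d v + ∑ v ∈ A \ X, d v + ∑ v ∈ D, d v + ∑ v ∈ S, d v ≤
      #(X \ W) * (Fintype.card V - 1) + #(X \ W) * #S + 8 * r + 4 := by omega
  zify [show 1 ≤ Fintype.card V by omega] at hle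
  rw [show (#(X \ W) : ℤ) = r - 5 by omega, show (#S : ℤ) = Fintype.card V - r - 2 by omega] at hle
  unfold sumBound at hsum
  push_cast at hsum
  nlinarith

end Obstruction

theorem IsStuck.exists_mem_right_inter (h : IsStuck d (coreGraph T W ⊥) (T ∪ W ∪ M) c F)
    (hJ : IsJoinCore r d T W) (hcD : c ∈ D) (hinner : ∀ a ∈ (T ∪ W) \ X,
      (∀ b ∈ D, ¬ F.Adj a b) ∧ ∀ x ∈ T ∪ W, x ≠ a → F.Adj a x) : ∃ w ∈ W, w ∈ X := by
  by_contra! hcon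
  have hW : ∀ w ∈ W, w ∈ (T ∪ W) \ X := fun w hw =>
    mem_sdiff.2 ⟨mem_union_right _ hw, hcon w hw⟩
  obtain ⟨w, hw, w', hw', hne⟩ := one_lt_card.1 (by rw [hJ.card_right]; norm_num : 1 < #W)
  have hww := (hinner w (hW w hw)).2 w' (mem_union_right _ hw') hne.symm
  have hfree : ¬ (coreGraph T W ⊥).Adj w w' := by
    rw [coreGraph_adj_of_mem_right hJ.disjoint hw hw']
    exact id
  rcases h.adj_or_adj_of_free_adj (mem_union_left _ (mem_union_right _ hw))
    (mem_union_left _ (mem_union_right _ hw')) hww hfree with hwc | hwc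
  · exact (hinner w (hW w hw)).1 c hcD hwc
  · exact (hinner w' (hW w' hw')).1 c hcD hwc

/-- The extremal case of `inner_bounds`, in which exactly three core vertices do not reach the
rest. -/
theorem IsStuck.false_of_card_inner_eq_three (h : IsStuck d (coreGraph T W ⊥) (T ∪ W ∪ M) c F)
    (ho : Obstruction d F (T ∪ W) X D S c) (hd : HasLargeSum r d) (hJ : IsJoinCore r d T W)
    (hI : #((T ∪ W) \ X) = 3) (he : ∑ a ∈ (T ∪ W) \ X, degIn F D a = 0)
    (hA : ∀ a ∈ T ∪ W, r ≤ d a) (hsmall : ∀ v ∉ T ∪ W, d v ≤ r)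
    (hE : ∑ b ∈ D, degIn F S b + (d c - deg F c) ≤ #D * (3 - #D)) : False := by
  have hinner : ∀ a ∈ (T ∪ W) \ X,
      (∀ b ∈ D, ¬ F.Adj a b) ∧ d a = r ∧ ∀ x ∈ T ∪ W, x ≠ a → F.Adj a x := fun a ha =>
    ho.inner_of_sum_eq_zero hJ.card_union he ha (hA a (sdiff_subset ha))
  obtain ⟨w₀, hw₀, hw₀X⟩ := h.exists_mem_right_inter hJ ho.mem fun a ha =>
    ⟨(hinner a ha).1, (hinner a ha).2.2⟩
  obtain ⟨a₀, ha₀T, ha₀⟩ : ∃ a ∈ T, a ∈ (T ∪ W) \ X := by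
    by_contra! hcon
    have hsub : (T ∪ W) \ X ⊆ W := fun a ha =>
      (mem_union.1 (sdiff_subset ha)).resolve_left fun haT => hcon a haT ha
    rw [← eq_of_subset_of_card_le hsub (by rw [hI, hJ.card_right])] at hw₀
    exact (mem_sdiff.1 hw₀).2 hw₀X
  have hdW : ∀ w ∈ W, d w ≤ r := fun w hw => (hJ.le_left a₀ ha₀T w hw).trans (hinner a₀ ha₀).2.1.le
  have hright : ∀ w ∈ W, w ∈ X → #D = 1 ∧ degIn F S w = 1 ∧ degIn F W w = 0 := fun w hw hwX =>
    ho.right_of_demand_le hJ.disjoint (fun a ha => (h.le (coreGraph_adj_of_ne ha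
      (mem_union_right _ hw) fun haw => disjoint_left.1 hJ.disjoint ha (haw ▸ hw))).symm) hwX
      (hJ.card_left ▸ hdW w hw)
  have hWX : W ⊆ X := fun w hw => by
    by_contra hwX
    exact degIn_eq_zero_iff.1 (hright w₀ hw₀ hw₀X).2.2 w hw ((hinner w (mem_sdiff.2
      ⟨mem_union_right _ hw, hwX⟩)).2.2 w₀
      (mem_union_right _ hw₀) fun hww => hwX (hww ▸ hw₀X)).symm
  have hD := (hright w₀ hw₀ hw₀X).1
  have hcard := card_sdiff_add_card_eq_card ho.subset
  rw [hI, hJ.card_union] at hcard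
  rw [hD] at hE
  have hlt := ho.deg_lt
  refine ho.false_of_card_treated_eq_one hd hWX hJ.card_right hI (by omega) hD (fun v hv => ?_)
    (fun w hw => (hright w hw (hWX hw)).2.1) (by omega)
  by_cases hvA : v ∈ T ∪ W
  · by_cases hvX : v ∈ X
    · exact hdW v (by simpa [hvX] using hv)
    · exact (hinner v (mem_sdiff.2 ⟨hvA, hvX⟩)).2.1.le
  · exact hsmall v hvA

theorem IsStuck.false_of_isJoinCore (h : IsStuck d (coreGraph T W ⊥) (T ∪ W ∪ M) c F)
    (hdis : Disjoint (T ∪ W) M) (hM : ∀ m ∈ M, d c ≤ d m)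
    (hrest : ∀ s, s ∉ T ∪ W → s ∉ M → d s ≤ d c) (hd : HasLargeSum r d) (hJ : IsJoinCore r d T W)
    (hG : ∀ v, deg G v = d v) : False := by
  set A := T ∪ W
  have hΦ : ∀ x y, (coreGraph T W ⊥).Adj x y → x ∈ A := fun x y h => mem_of_coreGraph_adj h
  obtain ⟨X, ho⟩ := h.exists_obstruction hdis hM hΦ
  have hcA : ∀ b ∈ insert c M, b ∉ A := fun b hb => disjoint_right.1 ho.disjoint hb
  have hcard := card_sdiff_add_card_eq_card ho.subset
  rw [hJ.card_union] at hcard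
  rcases (A \ X).eq_empty_or_nonempty with hX | ⟨a₁, ha₁⟩
  · obtain rfl := ho.subset.antisymm (sdiff_eq_empty_iff_subset.1 hX)
    exact h.false_of_obstruction_self hΦ (fun a ha => hJ.le_of_notMem ha (hcA c ho.mem)) hG ho
  obtain ⟨b₀, hb₀, hmax⟩ := exists_max_image (insert c M) d ⟨c, ho.mem⟩
  have hA : ∀ a ∈ A, d b₀ ≤ d a := fun a ha => hJ.le_of_notMem ha (hcA b₀ hb₀)
  have hsmall : ∀ v ∉ A, d v ≤ d b₀ := fun v hv => by
    by_cases hvM : v ∈ M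
    · exact hmax v (mem_insert_of_mem hvM)
    · exact (hrest v hv hvM).trans (hmax c ho.mem)
  obtain ⟨hlt, hK, htight⟩ := ho.inner_bounds_of_le hJ.card_union ⟨a₁, ha₁⟩ hmax hA
  have hgap := ho.deg_lt
  by_cases hI : 4 ≤ #(A \ X)
  · refine ho.false_of_card_add_le hd zero_le_one hJ.card_union (by omega)
      (fun v hv => (hsmall v hv).trans_lt hlt) ?_
    rw [show r + 1 - (#X + #(insert c M)) = #(A \ X) - #(insert c M) by omega]
    omega
  · obtain ⟨hI', hr, he⟩ := htight (by omega)
    exact h.false_of_card_inner_eq_three ho hd hJ hI' he (hr ▸ hA) (hr ▸ hsmall) (hI' ▸ hK)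

end JoinCore

section JoinCoreRealization

variable {V : Type*} [DecidableEq V] {d : V → ℕ} {F G : SimpleGraph V} {T W M : Finset V}
  {a b c m s w y : V} {r : ℕ}

theorem dominates_coreGraph_bot (hdis : Disjoint T W) (hm : m ∈ W) (hc : c ∈ W) (h : d c ≤ d m) :
    Dominates d (coreGraph T W ⊥) c m := by
  refine ⟨h, fun w hw => ?_⟩
  by_cases hwW : w ∈ W
  · exact ((coreGraph_adj_of_mem_right hdis hm hwW).1 hw).elim
  · have hwT := (mem_union.1 (mem_of_coreGraph_adj hw.symm)).resolve_right hwW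
    exact (coreGraph_adj_of_ne hwT (mem_union_right _ hc) fun hwc => hwW (hwc ▸ hc)).symm

theorem adj_of_coreGraph_le (hle : coreGraph T W ⊥ ≤ F) (hdis : Disjoint T W) (hw : w ∈ W) :
    ∀ a ∈ T, F.Adj w a := fun _ ha =>
  (hle (coreGraph_adj_of_ne ha (mem_union_right _ hw) (disjoint_left.1 hdis ha <| · ▸ hw))).symm

variable [Fintype V]

/-- The clique vertex `a` is not joined to the vertex `s ≠ c`, although `s` has not reached its
demand. -/
structure IsMissed (d : V → ℕ) (F : SimpleGraph V) (T : Finset V) (c a s : V) : Prop where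
  mem : a ∈ T
  ne : s ≠ c
  deg_lt : deg F s < d s
  not_adj : ¬ F.Adj a s

namespace IsStuck

/-- If every deficient vertex is joined to all of `T`, the saturated set is a clique that refutes
the Erdős–Gallai inequality. -/
theorem false_of_forall_adj (h : IsStuck d (coreGraph T W ⊥) (T ∪ M) c F) (hdis : Disjoint T W)
    (hM : M ⊆ W) (hc : c ∈ W) (hdM : ∀ m ∈ M, d c ≤ d m) (hG : ∀ v, deg G v = d v)
    (hT : ∀ s, s ≠ c → deg F s < d s → ∀ a ∈ T, F.Adj a s) : False := by
  have hdom : ∀ m ∈ M, Dominates d (coreGraph T W ⊥) c m := fun m hm =>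
    dominates_coreGraph_bot hdis (hM hm) hc (hdM m hm)
  have hL : ∀ m ∈ M, m ∈ T ∪ M := fun m hm => mem_union_right _ hm
  have hW : ∀ x ∈ insert c (T ∪ M), x ∉ T → x ∈ W ∧ (x = c ∨ x ∈ M) := fun x hx hxT => by
    simp only [mem_insert, mem_union, hxT, false_or] at hx
    exact ⟨hx.elim (· ▸ hc) (hM ·), hx⟩
  refine h.false_of_clique hG (fun x hx y hy hne => ?_) fun s hs hsd x hx => ?_
  · by_cases hxT : x ∈ T <;> by_cases hyT : y ∈ T
    · exact h.le (coreGraph_adj_of_ne hxT (mem_union_left _ hyT) hne)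
    · exact (adj_of_coreGraph_le h.le hdis (hW y hy hyT).1 x hxT).symm
    · exact adj_of_coreGraph_le h.le hdis (hW x hx hxT).1 y hyT
    · rcases (hW x hx hxT).2 with rfl | hxM <;> rcases (hW y hy hyT).2 with rfl | hyM
      · exact absurd rfl hne
      · exact (h.adj_of_dominates (hL y hyM) (hdom y hyM)).symm
      · exact h.adj_of_dominates (hL x hxM) (hdom x hxM)
      · exact h.adj_of_dominates_of_dominates (hL x hxM) (hdom x hxM) (hL y hyM) (hdom y hyM) hne
  · have hsc : s ≠ c := fun hsc => hs (hsc ▸ mem_insert_self _ _)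
    by_cases hxT : x ∈ T
    · exact (hT s hsc hsd x hxT).symm
    · rcases (hW x hx hxT).2 with rfl | hxM
      · exact h.adj_of_deg_lt hsc hsd
      · exact h.adj_of_deg_lt_of_dominates hsc hsd (hL x hxM) (hdom x hxM)

theorem notMem_of_isMissed (h : IsStuck d (coreGraph T W ⊥) (T ∪ M) c F)
    (hs : IsMissed d F T c a s) : s ∉ T ∪ W := fun hsA => hs.not_adj <|
  h.le <| coreGraph_adj_of_ne hs.mem hsA fun has =>
    h.notMem_of_deg_lt hs.deg_lt (mem_union_left _ (has ▸ hs.mem))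

theorem adj_of_isMissed (h : IsStuck d (coreGraph T W ⊥) (T ∪ M) c F) (hM : M ⊆ W) (hc : c ∈ W)
    (hs : IsMissed d F T c a s) (hy : y ∉ T ∪ W) (hay : F.Adj a y) : F.Adj c y ∧ y ≠ s := by
  refine ⟨(h.adj_of_free_adj_of_not_adj_deg_lt (mem_union_left _ hs.mem)
    (fun hyL => hy (union_subset_union_right hM hyL)) ?_ hs.ne hay
    (fun hadj => hy (mem_of_coreGraph_adj hadj.symm)) hs.not_adj hs.deg_lt).1.symm, ?_⟩
  · rintro rfl
    exact hy (mem_union_right _ hc)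
  · rintro rfl
    exact hs.not_adj hay

/-- Outside the core, `a` sees at most the neighbours of `c` other than `s`; since `d c ≤ d a`, it
sees all of them, and `c` has no neighbour in `W`. -/
theorem degIn_of_isMissed (h : IsStuck d (coreGraph T W ⊥) (T ∪ M) c F) (hJ : IsJoinCore r d T W)
    (hM : M ⊆ W) (hc : c ∈ W) (hs : IsMissed d F T c a s) :
    degIn F W c = 0 ∧ degIn F (T ∪ W)ᶜ a + 1 = degIn F (T ∪ W)ᶜ c ∧
      d a = #T + 1 + degIn F (T ∪ W)ᶜ c ∧ d c = d a := by
  classical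
  have hout : degIn F (T ∪ W)ᶜ a + 1 ≤ degIn F (T ∪ W)ᶜ c := by
    simp only [degIn_eq_card_filter]
    refine card_lt_card ⟨fun y hy => ?_, fun hsub => ?_⟩
    · rw [mem_filter] at hy ⊢
      exact ⟨hy.1, (h.adj_of_isMissed hM hc hs (mem_compl.1 hy.1) hy.2).1⟩
    · exact hs.not_adj (mem_filter.1 (hsub (mem_filter.2 ⟨mem_compl.2 (h.notMem_of_isMissed hs),
        (h.adj_of_deg_lt hs.ne hs.deg_lt).symm⟩))).2
  have hdega := degIn_add_degIn_compl F (T ∪ W) a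
  rw [degIn_eq_card_sub_one (mem_union_left _ hs.mem) fun y hy hne =>
    h.le (coreGraph_adj_of_ne hs.mem hy hne.symm), hJ.card_union,
    h.deg_eq a (mem_union_left _ hs.mem)] at hdega
  have hdegc := degIn_add_degIn_compl F (T ∪ W) c
  rw [degIn_union F hJ.disjoint,
    degIn_eq_card_iff.2 (adj_of_coreGraph_le h.le hJ.disjoint hc)] at hdegc
  have hlt := h.deg_lt
  have hle := hJ.le_left a hs.mem c hc
  have hcard := hJ.card_left
  omega

theorem eq_empty_of_isMissed (h : IsStuck d (coreGraph T W ⊥) (T ∪ M) c F)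
    (hJ : IsJoinCore r d T W) (hM : M ⊆ W) (hc : c ∈ W) (hdM : ∀ m ∈ M, d c ≤ d m)
    (hs : IsMissed d F T c a s) : M = ∅ :=
  eq_empty_of_forall_notMem fun m hm =>
    degIn_eq_zero_iff.1 (h.degIn_of_isMissed hJ hM hc hs).1 m (hM hm) <|
      (h.adj_of_dominates (mem_union_right _ hm)
        (dominates_coreGraph_bot hJ.disjoint (hM hm) hc (hdM m hm))).symm

theorem adj_iff_of_isMissed (h : IsStuck d (coreGraph T W ⊥) T c F) (hJ : IsJoinCore r d T W)
    (hc : c ∈ W) (hs : IsMissed d F T c a s) (hy : y ∉ T ∪ W) :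
    F.Adj a y ↔ F.Adj c y ∧ y ≠ s := by
  classical
  replace h : IsStuck d (coreGraph T W ⊥) (T ∪ ∅) c F := by rwa [union_empty]
  have hsub : {y ∈ (T ∪ W)ᶜ | F.Adj a y} ⊆ {y ∈ (T ∪ W)ᶜ | F.Adj c y}.erase s := fun y hy => by
    rw [mem_filter] at hy
    have hcy := h.adj_of_isMissed (empty_subset W) hc hs (mem_compl.1 hy.1) hy.2
    exact mem_erase.2 ⟨hcy.2, mem_filter.2 ⟨hy.1, hcy.1⟩⟩
  have hcard := (h.degIn_of_isMissed hJ (empty_subset W) hc hs).2.1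
  simp only [degIn_eq_card_filter] at hcard
  have hsc : s ∈ ({y ∈ (T ∪ W)ᶜ | F.Adj c y} : Finset V) := mem_filter.2
    ⟨mem_compl.2 (h.notMem_of_isMissed hs), (h.adj_of_deg_lt hs.ne hs.deg_lt).symm⟩
  have heq := eq_of_subset_of_card_le hsub (by rw [card_erase_of_mem hsc]; omega)
  have hiff := Finset.ext_iff.1 heq y
  rw [mem_filter, mem_erase, mem_filter, mem_compl] at hiff
  tauto

theorem deg_eq_degIn_add (h : IsStuck d (coreGraph T W ⊥) T c F) (hy : y ∉ T) (hyc : y ≠ c) :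
    deg F y = degIn F T y + degIn F {c} y := by
  have hcompl : degIn F (T ∪ {c})ᶜ y = 0 := degIn_eq_zero_iff.2 fun z hz => by
    rw [mem_compl, mem_union, mem_singleton, not_or] at hz
    exact h.not_adj y hy hyc z hz.1 hz.2
  rw [← degIn_add_degIn_compl F (T ∪ {c}), hcompl, add_zero,
    degIn_union F (disjoint_singleton_right.2 h.notMem)]

theorem degIn_add_one_of_adj (h : IsStuck d (coreGraph T W ⊥) T c F) (hy : y ∉ T)
    (hcy : F.Adj c y) : degIn F T y + 1 = deg F y := by
  rw [h.deg_eq_degIn_add hy hcy.ne', degIn_eq_card_iff (X := {c}) |>.2 (by simpa using hcy.symm),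
    card_singleton]

theorem degIn_eq_of_not_adj (h : IsStuck d (coreGraph T W ⊥) T c F) (hy : y ∉ T) (hyc : y ≠ c)
    (hcy : ¬ F.Adj c y) : degIn F T y = d y := by
  have hdef : ¬ deg F y < d y := fun hlt => hcy (h.adj_of_deg_lt hyc hlt).symm
  rw [← (h.deg_le y).antisymm (not_lt.1 hdef), h.deg_eq_degIn_add hy hyc,
    degIn_eq_zero_iff (X := {c}) |>.2 (by simpa [F.adj_comm] using hcy), add_zero]

theorem le_card_of_mem_right (h : IsStuck d (coreGraph T W ⊥) T c F) (hJ : IsJoinCore r d T W)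
    (hc : c ∈ W) (hs : IsMissed d F T c a s) (hw : w ∈ W) (hwc : w ≠ c) : d w ≤ #T := by
  have h' : IsStuck d (coreGraph T W ⊥) (T ∪ ∅) c F := by rwa [union_empty]
  have hcW := degIn_eq_zero_iff.1 (h'.degIn_of_isMissed hJ (empty_subset W) hc hs).1
  rw [← h.degIn_eq_of_not_adj (disjoint_right.1 hJ.disjoint hw) hwc (hcW w hw)]
  exact degIn_le_card F T w

theorem le_card_of_notMem (h : IsStuck d (coreGraph T W ⊥) T c F) (hJ : IsJoinCore r d T W)
    (hc : c ∈ W) (hs : IsMissed d F T c a s) (hb : b ∉ T ∪ W) : d b ≤ #T := by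
  obtain ⟨w, hw, hwc⟩ := exists_mem_ne (by rw [hJ.card_right]; norm_num) c
  exact (hJ.le_right w hw b hb).trans (h.le_card_of_mem_right hJ hc hs hw hwc)

theorem exists_not_adj_of_adj (h : IsStuck d (coreGraph T W ⊥) T c F) (hJ : IsJoinCore r d T W)
    (hc : c ∈ W) (hs : IsMissed d F T c a s) (hy : y ∉ T ∪ W) (hcy : F.Adj c y) :
    ∃ x ∈ T, ¬ F.Adj x y := by
  by_contra! hall
  have hTy := degIn_eq_card_iff.2 fun x hx => (hall x hx).symm
  have hdeg := h.degIn_add_one_of_adj (fun hyT => hy (mem_union_left _ hyT)) hcy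
  have hle := h.deg_le y
  have hdy := h.le_card_of_notMem hJ hc hs hy
  omega

theorem exists_isMissed_ne (h : IsStuck d (coreGraph T W ⊥) T c F) (hJ : IsJoinCore r d T W)
    (hc : c ∈ W) (hs : IsMissed d F T c a s) : ∃ a' ≠ a, IsMissed d F T c a' s := by
  by_contra! hall
  have hsA : s ∉ T ∪ W := IsStuck.notMem_of_isMissed (M := ∅) (by rwa [union_empty]) hs
  have hadj : ∀ x ∈ T.erase a, F.Adj s x := fun x hx => by
    rw [mem_erase] at hx
    by_contra hsx
    exact hall x hx.1 ⟨hx.2, hs.ne, hs.deg_lt, fun hxs => hsx hxs.symm⟩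
  have hTs := degIn_eq_card_iff.2 hadj
  have hmono := degIn_mono F (erase_subset a T) s
  have hdeg := h.degIn_add_one_of_adj (fun hsT => hsA (mem_union_left _ hsT))
    (h.adj_of_deg_lt hs.ne hs.deg_lt).symm
  have hds := h.le_card_of_notMem hJ hc hs hsA
  have hlt := hs.deg_lt
  rw [card_erase_of_mem hs.mem] at hTs
  omega

/-- Rotating an edge `ay` onto the missed vertex `s` makes `y` a missed vertex, so every neighbour
`y` of `c` outside the core is the one missed by some vertex of `T`. -/
theorem exists_forall_adj_iff (h : IsStuck d (coreGraph T W ⊥) T c F) (hJ : IsJoinCore r d T W)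
    (hc : c ∈ W) (hs : IsMissed d F T c a s) (hy : y ∉ T ∪ W) (hcy : F.Adj c y) :
    ∃ x ∈ T, ∀ z ∉ T ∪ W, F.Adj x z ↔ F.Adj c z ∧ z ≠ y := by
  by_cases hys : y = s
  · subst hys
    exact ⟨a, hs.mem, fun z hz => h.adj_iff_of_isMissed hJ hc hs hz⟩
  have hay : F.Adj a y := (h.adj_iff_of_isMissed hJ hc hs hy).2 ⟨hcy, hys⟩
  obtain ⟨x, hxT, hxy⟩ := h.exists_not_adj_of_adj hJ hc hs hy hcy
  have hxa : x ≠ a := by rintro rfl; exact hxy hay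
  have hca : c ≠ a := by rintro rfl; exact h.notMem hs.mem
  have has : a ≠ s := by rintro rfl; exact h.notMem_of_deg_lt hs.deg_lt hs.mem
  have hza : ∀ z ∉ T ∪ W, z ≠ a := by rintro z hz rfl; exact hz (mem_union_left _ hs.mem)
  obtain ⟨hrot, hlt⟩ := h.rotate hs.mem (fun hyT => hy (mem_union_left _ hyT)) hcy.ne' hs.ne hay
    (fun hadj => hy (mem_of_coreGraph_adj hadj.symm)) hs.not_adj hs.deg_lt
  have hcongr : ∀ u z, u ≠ a → z ≠ a → ((rotateEdge F a y s).Adj u z ↔ F.Adj u z) := by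
    intro u z hu hz
    rw [rotateEdge_adj hay has]
    tauto
  have hmiss : IsMissed d (rotateEdge F a y s) T c x y :=
    ⟨hxT, hcy.ne', hlt, by rwa [hcongr x y hxa (hza y hy)]⟩
  refine ⟨x, hxT, fun z hz => ?_⟩
  rw [← hcongr x z hxa (hza z hz), ← hcongr c z hca (hza z hz)]
  exact hrot.adj_iff_of_isMissed hJ hc hmiss hz

theorem degIn_compl_le_card (h : IsStuck d (coreGraph T W ⊥) T c F) (hJ : IsJoinCore r d T W)
    (hc : c ∈ W) (hs : IsMissed d F T c a s) : degIn F (T ∪ W)ᶜ c ≤ #T := by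
  classical
  choose! φ hφT hφ using fun y (hy : y ∉ T ∪ W ∧ F.Adj c y) =>
    h.exists_forall_adj_iff hJ hc hs hy.1 hy.2
  rw [degIn_eq_card_filter]
  refine card_le_card_of_injOn φ (fun y hy => hφT y (by simpa using hy)) ?_
  intro y hy y' hy' heq
  replace hy : y ∉ T ∪ W ∧ F.Adj c y := by simpa using hy
  replace hy' : y' ∉ T ∪ W ∧ F.Adj c y' := by simpa using hy'
  by_contra hne
  have hadj := (hφ y hy y' hy'.1).2 ⟨hy'.2, Ne.symm hne⟩
  rw [heq] at hadj
  exact ((hφ y' hy' y' hy'.1).1 hadj).2 rfl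

theorem add_two_le_of_notMem (h : IsStuck d (coreGraph T W ⊥) T c F) (hJ : IsJoinCore r d T W)
    (hc : c ∈ W) (hs : IsMissed d F T c a s) (hb : b ∉ T ∪ W) :
    d b + 2 ≤ #T + 2 * degIn F {c} b := by
  have hbT : b ∉ T := fun hbT => hb (mem_union_left _ hbT)
  have hbc : b ≠ c := by rintro rfl; exact hb (mem_union_right _ hc)
  by_cases hcb : F.Adj c b
  · rw [degIn_eq_card_iff.2 (by simpa using hcb.symm), card_singleton]
    have hdb := h.le_card_of_notMem hJ hc hs hb
    omega
  · obtain ⟨a', hne, hs'⟩ := h.exists_isMissed_ne hJ hc hs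
    have hsub : {a, a'} ⊆ T := by simp [insert_subset_iff, hs.mem, hs'.mem]
    have hzero : degIn F {a, a'} b = 0 := degIn_eq_zero_iff.2 <| by
      simp only [mem_insert, mem_singleton, forall_eq_or_imp, forall_eq]
      exact ⟨fun hba => hcb ((h.adj_iff_of_isMissed hJ hc hs hb).1 hba.symm).1,
        fun hba => hcb ((h.adj_iff_of_isMissed hJ hc hs' hb).1 hba.symm).1⟩
    have hT := degIn_add_degIn_sdiff F hsub b
    have hle := degIn_le_card F (T \ {a, a'}) b
    have hcard := card_sdiff_add_card_eq_card hsub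
    rw [card_pair hne.symm] at hcard
    rw [h.degIn_eq_of_not_adj hbT hbc hcb] at hT
    omega

theorem sum_right_le_of_isMissed (h : IsStuck d (coreGraph T W ⊥) T c F) (hJ : IsJoinCore r d T W)
    (hc : c ∈ W) (hs : IsMissed d F T c a s) : ∑ w ∈ W, d w ≤ d c + 2 * #T := by
  rw [← add_sum_erase W d hc]
  have hsum : ∑ w ∈ W.erase c, d w ≤ #(W.erase c) • #T := sum_le_card_nsmul _ _ _ fun w hw =>
    h.le_card_of_mem_right hJ hc hs (mem_of_mem_erase hw) (ne_of_mem_erase hw)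
  rw [card_erase_of_mem hc, hJ.card_right, smul_eq_mul] at hsum
  omega

theorem sum_compl_le_of_isMissed (h : IsStuck d (coreGraph T W ⊥) T c F) (hJ : IsJoinCore r d T W)
    (hc : c ∈ W) (hs : IsMissed d F T c a s) :
    ∑ b ∈ (T ∪ W)ᶜ, d b + #(T ∪ W)ᶜ * 2 ≤ #(T ∪ W)ᶜ * #T + 2 * degIn F (T ∪ W)ᶜ c := by
  have hsum := sum_le_sum fun b hb => h.add_two_le_of_notMem hJ hc hs (mem_compl.1 hb)
  simp only [sum_add_distrib, sum_const, smul_eq_mul, ← mul_sum] at hsum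
  rwa [sum_degIn_comm, sum_singleton] at hsum

theorem sum_left_le_of_isMissed (h : IsStuck d (coreGraph T W ⊥) T c F) (hJ : IsJoinCore r d T W)
    (hG : ∀ v, deg G v = d v) (hc : c ∈ W) (hs : IsMissed d F T c a s) :
    ∑ x ∈ T, d x ≤ 2 * d c + (#T - 2) * (Fintype.card V - 1) := by
  have h' : IsStuck d (coreGraph T W ⊥) (T ∪ ∅) c F := by rwa [union_empty]
  obtain ⟨a', hne, hs'⟩ := h.exists_isMissed_ne hJ hc hs
  have hsub : {a, a'} ⊆ T := by simp [insert_subset_iff, hs.mem, hs'.mem]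
  have hda := (h'.degIn_of_isMissed hJ (empty_subset W) hc hs).2.2.2
  have hda' := (h'.degIn_of_isMissed hJ (empty_subset W) hc hs').2.2.2
  have hrest : ∑ x ∈ T \ {a, a'}, d x ≤ #(T \ {a, a'}) • (Fintype.card V - 1) :=
    sum_le_card_nsmul _ _ _ fun x _ => by
      rw [← hG x, ← card_univ]
      exact degIn_le_card_sub_one G (mem_univ x)
  rw [card_sdiff_of_subset hsub, card_pair hne.symm, smul_eq_mul] at hrest
  rw [← sum_sdiff hsub, sum_pair hne.symm]
  omega

theorem false_of_isMissed (h : IsStuck d (coreGraph T W ⊥) T c F) (hd : HasLargeSum r d)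
    (hJ : IsJoinCore r d T W) (hG : ∀ v, deg G v = d v) (hc : c ∈ W)
    (hs : IsMissed d F T c a s) : False := by
  have h' : IsStuck d (coreGraph T W ⊥) (T ∪ ∅) c F := by rwa [union_empty]
  obtain ⟨-, -, hda, hdc⟩ := h'.degIn_of_isMissed hJ (empty_subset W) hc hs
  have hleft := h.sum_left_le_of_isMissed hJ hG hc hs
  have hright := h.sum_right_le_of_isMissed hJ hc hs
  have hcompl := h.sum_compl_le_of_isMissed hJ hc hs
  have hN := h.degIn_compl_le_card hJ hc hs
  have hsum : ∑ v, d v = ∑ x ∈ T, d x + ∑ w ∈ W, d w + ∑ b ∈ (T ∪ W)ᶜ, d b := by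
    rw [← sum_union hJ.disjoint, sum_add_sum_compl]
  have hcard := card_add_card_compl (T ∪ W)
  have hlarge := hd.le_sum
  have hn := hd.le_card
  have hr := hd.six_le
  have hT := hJ.card_left
  rw [hJ.card_union] at hcard
  rw [sumBound, ← Nat.cast_sum] at hlarge
  zify [show 2 ≤ #T by omega, show 1 ≤ Fintype.card V by omega] at *
  nlinarith

end IsStuck

theorem IsStuck.false_of_mem_right (h : IsStuck d (coreGraph T W ⊥) (T ∪ M) c F)
    (hd : HasLargeSum r d) (hJ : IsJoinCore r d T W) (hG : ∀ v, deg G v = d v) (hM : M ⊆ W)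
    (hc : c ∈ W) (hdM : ∀ m ∈ M, d c ≤ d m) : False := by
  refine h.false_of_forall_adj hJ.disjoint hM hc hdM hG fun s hsc hs a ha => ?_
  by_contra has
  have hmiss : IsMissed d F T c a s := ⟨ha, hsc, hs, has⟩
  obtain rfl := h.eq_empty_of_isMissed hJ hM hc hdM hmiss
  rw [union_empty] at h
  exact h.false_of_isMissed hd hJ hG hc hmiss

/-- The vertices of `W` are saturated one at a time, in order of decreasing demand. -/
theorem IsSubrealization.exists_union_right (hF : IsSubrealization d (coreGraph T W ⊥) T F)
    (hd : HasLargeSum r d) (hJ : IsJoinCore r d T W) (hG : ∀ v, deg G v = d v) :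
    ∃ F', IsSubrealization d (coreGraph T W ⊥) (T ∪ W) F' := by
  have heven : Even (∑ v, d v) := by simpa only [hG] using even_sum_deg G
  suffices key : ∀ k ≤ #W, ∃ M ⊆ W, #M = k ∧ (∀ m ∈ M, ∀ w ∈ W \ M, d w ≤ d m) ∧
      ∃ F', IsSubrealization d (coreGraph T W ⊥) (T ∪ M) F' by
    obtain ⟨M, hMW, hM, -, hF'⟩ := key #W le_rfl
    rwa [eq_of_subset_of_card_le hMW hM.ge] at hF'
  intro k hk
  induction k with
  | zero => exact ⟨∅, empty_subset W, card_empty, by simp, F, by rwa [union_empty]⟩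
  | succ k ih =>
    obtain ⟨M, hMW, hM, hdM, F₁, hF₁⟩ := ih (by omega)
    obtain ⟨c, hc, hmax⟩ := exists_max_image (W \ M) d <| by
      rw [← card_pos, card_sdiff_of_subset hMW]
      omega
    obtain ⟨hcW, hcM⟩ := mem_sdiff.1 hc
    refine ⟨insert c M, insert_subset hcW hMW, by rw [card_insert_of_notMem hcM, hM], ?_, ?_⟩
    · intro m hm w hw
      rw [sdiff_insert, mem_erase] at hw
      rcases mem_insert.1 hm with rfl | hm
      · exact hmax w hw.2
      · exact hdM m hm w hw.2
    · have hforced : ∀ s ∉ T ∪ M, ∀ s' ∉ T ∪ M, ¬ (coreGraph T W ⊥).Adj s s' := by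
        rintro s hs s' hs' ⟨-, h | h | h⟩
        · exact hs (mem_union_left _ h.1)
        · exact hs' (mem_union_left _ h.1)
        · exact h.2.2
      rw [union_insert]
      refine (hF₁.exists_insert_or_isStuck ?_ heven hforced).resolve_right fun ⟨F', hF'⟩ =>
        hF'.false_of_mem_right hd hJ hG hMW hcW fun m hm => hdM m hm c hc
      rw [mem_union, not_or]
      exact ⟨disjoint_right.1 hJ.disjoint hcW, hcM⟩

theorem exists_realization_coreGraph_bot (hG : ∀ v, deg G v = d v) (hd : HasLargeSum r d)
    (hJ : IsJoinCore r d T W) (hT : ∀ a ∈ T, r ≤ d a) (hW : ∀ w ∈ W, #T ≤ d w) :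
    ∃ G', coreGraph T W ⊥ ≤ G' ∧ ∀ v, deg G' v = d v := by
  have hbot : ∀ w, degIn (⊥ : SimpleGraph V) W w = 0 := fun w => degIn_eq_zero_iff.2 (by simp)
  have hcard := hJ.card_left
  have hcard' := hJ.card_right
  obtain ⟨F, hF, -⟩ := exists_isSubrealization_coreGraph (Γ := ⊥) hG hJ.disjoint
    (fun a ha => by have := hT a ha; omega) (fun w hw => by rw [hbot]; exact hW w hw)
  obtain ⟨F', hF'⟩ := hF.exists_union_right hd hJ hG
  exact hF'.exists_realization (by simpa only [hG] using even_sum_deg G)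
    (fun s hs s' _ hadj => hs (mem_of_coreGraph_adj hadj))
    fun M c F hdis hM hrest h => h.false_of_isJoinCore hdis hM hrest hd hJ hG

end JoinCoreRealization

section Containment

variable {U V W ι : Type*} {G : SimpleGraph V}

/-- It suffices to place the vertices `h i`: the remaining ones go to vertices of `T`, which are
joined to everything used. -/
theorem isContained_of_universal [Fintype U] [Fintype ι] [DecidableEq V] {K : SimpleGraph U}
    {T : Finset V} (h : ι ↪ U) (e : ι ↪ V) (hdis : Disjoint T (univ.map e))
    (hcard : #T + Fintype.card ι = Fintype.card U)
    (hT : ∀ a ∈ T, ∀ x ∈ T ∪ univ.map e, a ≠ x → G.Adj a x)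
    (hK : ∀ i j, K.Adj (h i) (h j) → G.Adj (e i) (e j)) : K.IsContained G := by
  classical
  have hcardT : Fintype.card ↥(Set.range h)ᶜ = Fintype.card T := by
    rw [Fintype.card_compl_set, Set.card_range_of_injective h.injective, Fintype.card_coe]
    omega
  let τ : ↥(Set.range h)ᶜ ≃ T := Fintype.equivOfCardEq hcardT
  let ε : ι ⊕ ↥(Set.range h)ᶜ ≃ U := ((Equiv.ofInjective h h.injective).sumCongr
    (Equiv.refl _)).trans (Equiv.Set.sumCompl (Set.range h))
  let φ : ι ⊕ ↥(Set.range h)ᶜ → V := Sum.elim e fun x => τ x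
  have hφ : Function.Injective φ := e.injective.sumElim
    (Subtype.val_injective.comp τ.injective) fun i x heq =>
      disjoint_left.1 hdis (τ x).2 (heq ▸ mem_map_of_mem e (mem_univ i))
  have hmem : ∀ x, φ x ∈ T ∪ univ.map e := by
    rintro (i | x)
    · exact mem_union_right _ (mem_map_of_mem e (mem_univ i))
    · exact mem_union_left _ (τ x).2
  refine ⟨⟨φ ∘ ε.symm, fun {u v} huv => ?_⟩, hφ.comp ε.symm.injective⟩
  have hne : φ (ε.symm u) ≠ φ (ε.symm v) := (hφ.comp ε.symm.injective).ne huv.ne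
  obtain ⟨u, rfl⟩ := ε.surjective u
  obtain ⟨v, rfl⟩ := ε.surjective v
  simp only [Function.comp_apply, Equiv.symm_apply_apply] at hne ⊢
  rcases u with i | x
  · rcases v with j | y
    · exact hK i j huv
    · exact (hT _ (τ y).2 _ (hmem (Sum.inl i)) hne.symm).symm
  · exact hT _ (τ x).2 _ (hmem v) hne

theorem completeMinus_adj_apply {m : ℕ} {H : SimpleGraph W} {f : W ↪ Fin m} {x y : W} :
    (completeMinus H f).Adj (f x) (f y) ↔ x ≠ y ∧ ¬ H.Adj x y := by
  rw [completeMinus, SimpleGraph.sdiff_adj, SimpleGraph.map_adj_apply, SimpleGraph.top_adj,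
    f.injective.ne_iff]

theorem potentiallyGraphic_of_coreGraph [Fintype ι] {n m : ℕ} {d : Fin n → ℕ} {H : SimpleGraph W}
    {f : W ↪ Fin m} {T X : Finset (Fin n)} {Γ : SimpleGraph (Fin n)} (e : ι ↪ Fin n) (g : ι ↪ W)
    (he : ∀ i, e i ∈ X) (hdis : Disjoint T X) (hcard : #T + Fintype.card ι = m)
    (hΓ : ∀ i j, i ≠ j → ¬ H.Adj (g i) (g j) → Γ.Adj (e i) (e j))
    (h : ∃ G, coreGraph T X Γ ≤ G ∧ ∀ v, deg G v = d v) :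
    PotentiallyGraphic (completeMinus H f) d := by
  obtain ⟨G, hle, hG⟩ := h
  have hX : univ.map e ⊆ X := fun x hx => by
    obtain ⟨i, -, rfl⟩ := mem_map.1 hx
    exact he i
  refine ⟨G, fun i => (ncard_neighborSet_eq_deg G i).trans (hG i), ?_⟩
  refine isContained_of_universal (g.trans f) e (hdis.mono_right hX) (by simpa using hcard)
    (fun a ha x hx hne => hle (coreGraph_adj_of_ne ha (union_subset_union_right hX hx) hne))
    fun i j hadj => hle ?_
  obtain ⟨hne, hnot⟩ := completeMinus_adj_apply.1 hadj
  exact (coreGraph_adj_of_mem_right hdis (he i) (he j)).2 (hΓ i j (g.injective.ne_iff.1 hne) hnot)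

theorem degIn_map [Fintype ι] (e : ι ↪ V) (Γ : SimpleGraph ι) (i : ι) :
    degIn (Γ.map e) (univ.map e) (e i) = deg Γ i := by
  classical
  rw [deg, degIn_eq_card_filter, degIn_eq_card_filter, filter_map, card_map]
  simp only [Function.comp_def, SimpleGraph.map_adj_apply]

end Containment

section SmallGraphs

open SimpleGraph

/-- `K_{3,2}` together with an edge inside its part of size three: the wheel with four spokes, less
one spoke. -/
def wheelMinusSpoke : SimpleGraph (Fin 3 ⊕ Fin 2) :=
  completeBipartiteGraph (Fin 3) (Fin 2) ⊔ edge (Sum.inl 0) (Sum.inl 1)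

theorem deg_wheelMinusSpoke (i : Fin 3 ⊕ Fin 2) :
    deg wheelMinusSpoke i = if i = Sum.inl 2 then 2 else 3 := by
  classical
  rw [deg, degIn_eq_card_filter]
  simp only [wheelMinusSpoke, sup_adj, edge_adj, completeBipartiteGraph_adj]
  decide +revert

theorem deg_completeBipartiteGraph (i : Fin 3 ⊕ Fin 3) :
    deg (completeBipartiteGraph (Fin 3) (Fin 3)) i = 3 := by
  classical
  rw [deg, degIn_eq_card_filter]
  simp only [completeBipartiteGraph_adj]
  decide +revert

theorem deg_pathGraph_four (i : Fin 4) :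
    deg (pathGraph 4) i = if i = 0 ∨ i = 3 then 1 else 2 := by
  classical
  rw [deg, degIn_eq_card_filter]
  simp only [pathGraph_adj]
  decide +revert

theorem deg_cycleGraph_four (i : Fin 4) : deg (cycleGraph 4) i = 2 := by
  rw [deg, degIn_eq_card_filter]
  decide +revert

/-- The vertices of `P_3` in an order in which consecutive ones are not adjacent: they form a path
in the complement. -/
def pathComplEmb : Fin 4 ↪ Fin 3 ⊕ Fin 4 :=
  ⟨Sum.inr ∘ ![2, 0, 3, 1], Sum.inr_injective.comp (by decide)⟩

theorem pathGraph_adj_of_not_adj {i j : Fin 4} (hij : i ≠ j)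
    (h : ¬ triangleUnionPath.Adj (pathComplEmb i) (pathComplEmb j)) : (pathGraph 4).Adj i j := by
  change ¬ (pathGraph 4).Adj (![2, 0, 3, 1] i) (![2, 0, 3, 1] j) at h
  simp only [pathGraph_adj] at h ⊢
  decide +revert

/-- The triangle and an end edge of the path. -/
def triangleEdgeEmb : Fin 3 ⊕ Fin 2 ↪ Fin 3 ⊕ Fin 4 :=
  (Function.Embedding.refl _).sumMap (Fin.castLEEmb (by norm_num))

theorem completeBipartiteGraph_adj_of_not_adj {i j : Fin 3 ⊕ Fin 2} (hij : i ≠ j)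
    (h : ¬ triangleUnionPath.Adj (triangleEdgeEmb i) (triangleEdgeEmb j)) :
    (completeBipartiteGraph (Fin 3) (Fin 2)).Adj i j := by
  rcases i with i | i <;> rcases j with j | j
  · exact absurd (fun hij' => hij (congrArg Sum.inl hij')) h
  · simp
  · simp
  · refine absurd (pathGraph_adj.2 ?_) h
    have hne : i.val ≠ j.val := fun h' => hij (congrArg Sum.inr (Fin.ext h'))
    change i.val + 1 = j.val ∨ j.val + 1 = i.val
    omega

end SmallGraphs

section Sequences

variable {δ : ℕ → ℕ} {n r : ℕ}

theorem exists_antitone_extension {d : Fin n → ℕ} (hd : Antitone d) (hn : 0 < n) :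
    ∃ δ : ℕ → ℕ, Antitone δ ∧ ∀ i : Fin n, d i = δ i :=
  ⟨fun j => d ⟨min j (n - 1), by omega⟩,
    fun _ _ hij => hd (Fin.mk_le_mk.2 (min_le_min_right _ hij)),
    fun i => congrArg d (Fin.ext (min_eq_left (by omega)).symm)⟩

theorem sum_le_of_antitone (hδ : Antitone δ) {k l : ℕ} {A B C : ℤ} (hkl : k ≤ l) (hln : l ≤ n)
    (hA : δ 0 ≤ A) (hB : δ k ≤ B) (hC : δ l ≤ C) :
    ∑ i : Fin n, (δ i : ℤ) ≤ k * A + (l - k) * B + (n - l) * C := by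
  obtain ⟨a, rfl⟩ := Nat.exists_eq_add_of_le hkl
  obtain ⟨b, rfl⟩ := Nat.exists_eq_add_of_le hln
  have sum_block_le : ∀ (s m : ℕ) {D : ℤ}, δ s ≤ D → ∑ i ∈ range m, (δ (s + i) : ℤ) ≤ m * D := by
    intro s m D hD
    simpa using sum_le_card_nsmul (range m) (fun i => (δ (s + i) : ℤ)) D
      fun i _ => (Nat.cast_le.2 (hδ (Nat.le_add_right s i))).trans hD
  rw [Fin.sum_univ_eq_sum_range (fun i => (δ i : ℤ)), sum_range_add, sum_range_add]
  have h₀ := sum_block_le 0 k hA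
  have h₁ := sum_block_le k a hB
  have h₂ := sum_block_le (k + a) b hC
  simp only [zero_add] at h₀
  push_cast
  linarith

/-- The first `m` vertices. -/
def initial (n m : ℕ) : Finset (Fin n) := {i | i.val < m}

theorem mem_initial {m : ℕ} {i : Fin n} : i ∈ initial n m ↔ i.val < m := by simp [initial]

theorem card_initial {m : ℕ} (h : m ≤ n) : #(initial n m) = m := by
  rw [initial, Fin.card_filter_val_lt, min_eq_right h]

theorem apply_zero_le_of_deg_eq {G : SimpleGraph (Fin n)} (hG : ∀ v, deg G v = δ v) (hn : 0 < n) :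
    δ 0 ≤ n - 1 := by
  have h : deg G ⟨0, hn⟩ ≤ #univ - 1 := degIn_le_card_sub_one G (mem_univ _)
  rwa [hG, card_univ, Fintype.card_fin] at h

namespace HasLargeSum

theorem sumBound_le (hd : HasLargeSum r fun i : Fin n => δ i) (hδ : Antitone δ)
    (h₀ : δ 0 ≤ n - 1) {k l : ℕ} {B C : ℤ} (hkl : k ≤ l) (hln : l ≤ n) (hB : δ k ≤ B)
    (hC : δ l ≤ C) : sumBound r n ≤ k * (n - 1) + (l - k) * B + (n - l) * C := by
  have hn : 5 * r + 18 ≤ n := by simpa using hd.le_card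
  have hsum := hd.le_sum
  rw [Fintype.card_fin] at hsum
  exact hsum.trans (sum_le_of_antitone hδ hkl hln (by omega) hB hC)

theorem sub_one_le_apply_sub_three (hd : HasLargeSum r fun i : Fin n => δ i) (hδ : Antitone δ)
    (h₀ : δ 0 ≤ n - 1) : r - 1 ≤ δ (r - 3) := by
  have hr := hd.six_le
  have hn : 5 * r + 18 ≤ n := by simpa using hd.le_card
  by_contra hlt
  have h := hd.sumBound_le hδ h₀ (k := r - 3) (B := r - 2) (C := r - 2) le_rfl (by omega)
    (by omega) (by omega)
  rw [sumBound] at h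
  push_cast [show 3 ≤ r by omega] at h
  linarith

theorem apply_sub_two_eq (hd : HasLargeSum r fun i : Fin n => δ i) (hδ : Antitone δ)
    (h₀ : δ 0 ≤ n - 1) (hle : δ (r - 3) ≤ r - 1) : δ (r - 2) = r - 1 := by
  have hr := hd.six_le
  have hn : 5 * r + 18 ≤ n := by simpa using hd.le_card
  have hanti : δ (r - 2) ≤ δ (r - 3) := hδ (by omega)
  by_contra hne
  have h := hd.sumBound_le hδ h₀ (k := r - 3) (l := r - 2) (B := r - 1) (C := r - 2) (by omega)
    (by omega) (by omega) (by omega)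
  rw [sumBound] at h
  push_cast [show 3 ≤ r by omega, show 2 ≤ r by omega] at h
  linarith

theorem apply_self_eq (hd : HasLargeSum r fun i : Fin n => δ i) (hδ : Antitone δ)
    (h₀ : δ 0 ≤ n - 1) (hle : δ (r - 4) ≤ r - 1) : δ r = r - 1 := by
  have hr := hd.six_le
  have hn : 5 * r + 18 ≤ n := by simpa using hd.le_card
  have hanti : δ r ≤ δ (r - 4) := hδ (by omega)
  by_contra hne
  have h := hd.sumBound_le hδ h₀ (k := r - 4) (l := r) (B := r - 1) (C := r - 2) (by omega)
    (by omega) (by omega) (by omega)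
  rw [sumBound] at h
  push_cast [show 4 ≤ r by omega] at h
  linarith

theorem succ_le_apply_sub_five (hd : HasLargeSum r fun i : Fin n => δ i) (hδ : Antitone δ)
    (h₀ : δ 0 ≤ n - 1) (hle : δ (r - 4) ≤ r - 1) : r + 1 ≤ δ (r - 5) := by
  have hr := hd.six_le
  have hn : 5 * r + 18 ≤ n := by simpa using hd.le_card
  by_contra hlt
  have h := hd.sumBound_le hδ h₀ (k := r - 5) (l := r - 4) (B := r) (C := r - 1) (by omega)
    (by omega) (by omega) (by omega)
  rw [sumBound] at h
  push_cast [show 4 ≤ r by omega, show 5 ≤ r by omega] at h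
  linarith

theorem sub_two_le_apply_succ (hd : HasLargeSum r fun i : Fin n => δ i) (hδ : Antitone δ)
    {G : SimpleGraph (Fin n)} (hG : ∀ v, deg G v = δ v) : r - 2 ≤ δ (r + 1) := by
  have hr := hd.six_le
  have hn : 5 * r + 18 ≤ n := by simpa using hd.le_card
  by_contra hlt
  have hcard : #(initial n (r + 1)) = r + 1 := card_initial (by omega)
  have hcompl : #(initial n (r + 1))ᶜ = n - (r + 1) := by
    rw [card_compl, hcard, Fintype.card_fin]
  have hsmall : ∀ v ∈ (initial n (r + 1))ᶜ, δ v ≤ r - 3 := fun v hv => by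
    rw [mem_compl, mem_initial] at hv
    have : δ v ≤ δ (r + 1) := hδ (by omega)
    omega
  have hsum_compl : ∑ v ∈ (initial n (r + 1))ᶜ, δ v ≤ (n - (r + 1)) * (r - 3) := by
    rw [← hcompl]
    exact sum_le_card_nsmul _ _ _ hsmall
  have hEG := sum_deg_le G (initial n (r + 1))
  simp only [hG, hcard] at hEG
  have hsum_min : ∑ v ∈ (initial n (r + 1))ᶜ, min (r + 1) (δ v) ≤ (n - (r + 1)) * (r - 3) :=
    (sum_le_sum fun v _ => min_le_right _ _).trans hsum_compl
  have hsum := hd.le_sum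
  rw [Fintype.card_fin, ← Nat.cast_sum, ← sum_add_sum_compl (initial n (r + 1)), sumBound] at hsum
  zify [show r + 1 ≤ n by omega, show 3 ≤ r by omega, Nat.add_sub_cancel]
    at hsum_compl hsum_min hEG hsum hn
  linarith

end HasLargeSum

end Sequences

section UpperBound

variable {δ : ℕ → ℕ} {n r : ℕ} {G : SimpleGraph (Fin n)}

/-- An exact core on the first `m` vertices and the vertices `m + σ i`, in which the graph
`K_{r+1} - H` only uses the positions in the range of `q`. -/
theorem potentiallyGraphic_of_exact {ι κ W : Type*} [Fintype ι] [Fintype κ] {H : SimpleGraph W}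
    (hG : ∀ v, deg G v = δ v) (hd : HasLargeSum r fun i : Fin n => δ i) (hδ : Antitone δ)
    {m k : ℕ} (hk : k ≤ 1) (hι : m + Fintype.card ι = r + 1 + k)
    (hκ : m + Fintype.card κ = r + 1) (hm : m + k + 3 ≤ r) (hle : ∀ i < m, r + k ≤ δ i)
    (hlt : δ m < r) {σ : ι → ℕ} (hσ : Function.Injective σ) (hσn : ∀ i, m + σ i < n)
    {Γ : SimpleGraph ι} (hΓ : ∀ i, δ (m + σ i) = m + deg Γ i) (q : κ ↪ ι) (g : κ ↪ W)
    (hH : ∀ i j, i ≠ j → ¬ H.Adj (g i) (g j) → Γ.Adj (q i) (q j)) (f : W ↪ Fin (r + 1)) :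
    PotentiallyGraphic (completeMinus H f) fun i : Fin n => δ i := by
  have hn : 5 * r + 18 ≤ n := by simpa using hd.le_card
  let e : ι ↪ Fin n := ⟨fun i => ⟨m + σ i, hσn i⟩, fun i j hij => hσ (by simpa using hij)⟩
  have hT : #(initial n m) = m := card_initial (by omega)
  have hdis : Disjoint (initial n m) (univ.map e) := by
    rw [disjoint_right]
    intro x hx hx'
    obtain ⟨i, -, rfl⟩ := mem_map.1 hx
    have : m + σ i < m := mem_initial.1 hx'
    omega
  refine potentiallyGraphic_of_coreGraph (Γ := Γ.map e) (q.trans e) g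
    (fun i => mem_map_of_mem e (mem_univ _)) hdis (by omega)
    (fun i j hij h => SimpleGraph.map_adj_apply.2 (hH i j hij h))
    (exists_realization_coreGraph_of_deg_eq hG hd hdis hk ?_ (by omega) ?_ ?_ ?_)
  · rw [hT, card_map, card_univ, hι]
  · exact fun a ha => hle a (mem_initial.1 ha)
  · intro w hw
    obtain ⟨i, -, rfl⟩ := mem_map.1 hw
    rw [degIn_map, hT]
    exact hΓ i
  · intro v hv
    rw [mem_union, mem_initial, not_or, not_lt] at hv
    exact (hδ hv.1).trans_lt hlt

variable (f : Fin 3 ⊕ Fin 4 ↪ Fin (r + 1))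

theorem potentiallyGraphic_of_le_apply_sub_three (hG : ∀ v, deg G v = δ v)
    (hd : HasLargeSum r fun i : Fin n => δ i) (hδ : Antitone δ) (h : r ≤ δ (r - 3)) :
    PotentiallyGraphic (completeMinus triangleUnionPath f) fun i : Fin n => δ i := by
  have hr := hd.six_le
  have hn : 5 * r + 18 ≤ n := by simpa using hd.le_card
  set T := initial n (r - 2)
  set W := initial n (r + 1) \ T
  have hsub : T ⊆ initial n (r + 1) := fun x hx => by
    rw [mem_initial] at hx ⊢
    omega
  have hT : #T = r - 2 := card_initial (by omega)
  have hW : #W = 3 := by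
    rw [card_sdiff_of_subset hsub, hT, card_initial (by omega)]
    omega
  have hmem {w : Fin n} (hw : w ∈ W) : r - 2 ≤ w.val ∧ w.val < r + 1 := by
    rwa [mem_sdiff, mem_initial, mem_initial, not_lt, and_comm] at hw
  have hJ : IsJoinCore r (fun i : Fin n => δ i) T W :=
    { disjoint := disjoint_sdiff
      card_left := by omega
      card_right := hW
      le_left := fun a ha w hw => hδ ((mem_initial.1 ha).le.trans (hmem hw).1)
      le_right := fun w hw b hb => by
        rw [union_sdiff_of_subset hsub, mem_initial, not_lt] at hb
        exact hδ ((hmem hw).2.le.trans hb) }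
  refine potentiallyGraphic_of_coreGraph
    ((equivFinOfCardEq hW).symm.toEmbedding.trans (Function.Embedding.subtype _))
    Function.Embedding.inl (fun i => Subtype.prop _) hJ.disjoint (by simp [hT]; omega)
    (fun i j hij h => absurd hij h)
    (exists_realization_coreGraph_bot hG hd hJ (fun a ha => ?_) fun w hw => ?_)
  · have := mem_initial.1 ha
    exact h.trans (hδ (by omega))
  · rw [hT]
    exact (hd.sub_two_le_apply_succ hδ hG).trans (hδ (hmem hw).2.le)

theorem potentiallyGraphic_of_le_apply_sub_four (hG : ∀ v, deg G v = δ v)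
    (hd : HasLargeSum r fun i : Fin n => δ i) (hδ : Antitone δ) (hlt : δ (r - 3) ≤ r - 1)
    (h : r ≤ δ (r - 4)) :
    PotentiallyGraphic (completeMinus triangleUnionPath f) fun i : Fin n => δ i := by
  have hr := hd.six_le
  have hn : 5 * r + 18 ≤ n := by simpa using hd.le_card
  have exact_core : ∀ (σ : Fin 4 → ℕ) (Γ : SimpleGraph (Fin 4)), Function.Injective σ →
      (∀ i, σ i ≤ 4) → (∀ i, δ (r - 3 + σ i) = r - 3 + deg Γ i) →
      SimpleGraph.pathGraph 4 ≤ Γ →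
      PotentiallyGraphic (completeMinus triangleUnionPath f) fun i : Fin n => δ i :=
    fun σ Γ hσ hσ4 hΓ hpath => potentiallyGraphic_of_exact hG hd hδ zero_le_one
      (by simp; omega) (by simp; omega) (by omega) (fun i hi => h.trans (hδ (by omega)))
      (by omega) hσ (fun i => by have := hσ4 i; omega) hΓ (.refl _) pathComplEmb
      (fun i j hij h => hpath (pathGraph_adj_of_not_adj hij h)) f
  by_cases hself : δ r = r - 1
  · refine exact_core Fin.val (SimpleGraph.cycleGraph 4) Fin.val_injective (fun i => by omega)
      (fun i => ?_) SimpleGraph.pathGraph_le_cycleGraph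
    have h_upper : δ (r - 3 + i) ≤ δ (r - 3) := hδ (by omega)
    have h_lower : δ r ≤ δ (r - 3 + i) := hδ (by omega)
    rw [deg_cycleGraph_four]
    omega
  · refine exact_core ![3, 0, 1, 4] (SimpleGraph.pathGraph 4) (by decide) (by decide)
      (fun i => ?_) le_rfl
    have h₀ : δ 0 ≤ n - 1 := apply_zero_le_of_deg_eq hG (by omega)
    have h_sub_three := hd.sub_one_le_apply_sub_three hδ h₀
    have h_sub_two := hd.apply_sub_two_eq hδ h₀ hlt
    have h_succ := hd.sub_two_le_apply_succ hδ hG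
    have anti : δ (r + 1) ≤ δ r ∧ δ r ≤ δ (r - 2) := ⟨hδ (by omega), hδ (by omega)⟩
    rw [deg_pathGraph_four]
    fin_cases i <;> simp [show r - 3 + 3 = r by omega, show r - 3 + 1 = r - 2 by omega,
      show r - 3 + 4 = r + 1 by omega] <;> omega

theorem potentiallyGraphic_of_apply_succ_eq (hG : ∀ v, deg G v = δ v)
    (hd : HasLargeSum r fun i : Fin n => δ i) (hδ : Antitone δ) (hlt : δ (r - 4) ≤ r - 1)
    (h_succ : δ (r + 1) = r - 1) :
    PotentiallyGraphic (completeMinus triangleUnionPath f) fun i : Fin n => δ i := by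
  have hr := hd.six_le
  have hn : 5 * r + 18 ≤ n := by simpa using hd.le_card
  have h₀ : δ 0 ≤ n - 1 := apply_zero_le_of_deg_eq hG (by omega)
  have hle : ∀ i < r - 4, r + 1 ≤ δ i := fun i hi =>
    (hd.succ_le_apply_sub_five hδ h₀ hlt).trans (hδ (by omega))
  let q : Fin 3 ⊕ Fin 2 ↪ Fin 3 ⊕ Fin 3 :=
    (Function.Embedding.refl _).sumMap (Fin.castLEEmb (by norm_num))
  refine potentiallyGraphic_of_exact (m := r - 4) (Γ := completeBipartiteGraph (Fin 3) (Fin 3))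
    hG hd hδ le_rfl (by simp; omega) (by simp; omega) (by omega) hle (by omega)
    (σ := fun i => finSumFinEquiv i) (Fin.val_injective.comp finSumFinEquiv.injective)
    (fun i => by omega) (fun i => ?_) q triangleEdgeEmb (fun i j hij h => ?_) f
  · have h_eq : δ (r - 4 + finSumFinEquiv i) = r - 1 :=
      le_antisymm ((hδ (by omega)).trans hlt) (h_succ.symm.le.trans (hδ (by omega)))
    rw [deg_completeBipartiteGraph, h_eq]
    omega
  · have := completeBipartiteGraph_adj_of_not_adj hij h
    rcases i with i | i <;> rcases j with j | j <;> simp_all [q]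

theorem potentiallyGraphic_of_apply_succ_lt (hG : ∀ v, deg G v = δ v)
    (hd : HasLargeSum r fun i : Fin n => δ i) (hδ : Antitone δ) (hlt : δ (r - 4) ≤ r - 1)
    (h_succ : δ (r + 1) < r - 1) :
    PotentiallyGraphic (completeMinus triangleUnionPath f) fun i : Fin n => δ i := by
  have hr := hd.six_le
  have hn : 5 * r + 18 ≤ n := by simpa using hd.le_card
  have h₀ : δ 0 ≤ n - 1 := apply_zero_le_of_deg_eq hG (by omega)
  have hle : ∀ i < r - 4, r ≤ δ i := fun i hi =>
    (Nat.le_succ r).trans ((hd.succ_le_apply_sub_five hδ h₀ hlt).trans (hδ (by omega)))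
  let σ : Fin 3 ⊕ Fin 2 → ℕ := Sum.elim ![0, 1, 5] ![2, 3]
  refine potentiallyGraphic_of_exact (m := r - 4) (Γ := wheelMinusSpoke) hG hd hδ zero_le_one
    (by simp; omega) (by simp; omega) (by omega) hle (by omega) (σ := σ) (by decide)
    (fun i => ?_) (fun i => ?_) (.refl _) triangleEdgeEmb
    (fun i j hij h => Or.inl (completeBipartiteGraph_adj_of_not_adj hij h)) f
  · have : σ i ≤ 5 := by decide +revert
    omega
  · have h_succ_ge := hd.sub_two_le_apply_succ hδ hG
    have h_self := hd.apply_self_eq hδ h₀ hlt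
    have h_eq : ∀ j ≤ 4, δ (r - 4 + j) = r - 1 := fun j hj =>
      le_antisymm ((hδ (by omega)).trans hlt) (h_self.symm.le.trans (hδ (by omega)))
    rw [deg_wheelMinusSpoke]
    split_ifs with hi
    · rw [hi, show r - 4 + σ (Sum.inl 2) = r + 1 by change r - 4 + 5 = r + 1; omega]
      omega
    · have : σ i ≤ 4 := by decide +revert
      rw [h_eq _ this]
      omega

theorem potentiallyGraphic_of_sumBound_le (hr : 6 ≤ r) (hn : 5 * r + 18 ≤ n) {d : Fin n → ℕ}
    (hd : IsGraphic d) (hsum : sumBound r n ≤ ∑ i, (d i : ℤ)) :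
    PotentiallyGraphic (completeMinus triangleUnionPath f) d := by
  obtain ⟨hanti, G, hreal⟩ := hd
  obtain ⟨δ, hδ, hdδ⟩ := exists_antitone_extension hanti (by omega)
  obtain rfl : d = fun i : Fin n => δ i := funext hdδ
  have hG : ∀ v, deg G v = δ v := fun v => (ncard_neighborSet_eq_deg G v).symm.trans (hreal v)
  have hlarge : HasLargeSum r fun i : Fin n => δ i :=
    ⟨hr, by rwa [Fintype.card_fin], by rwa [Fintype.card_fin]⟩
  by_cases h_three : r ≤ δ (r - 3)
  · exact potentiallyGraphic_of_le_apply_sub_three f hG hlarge hδ h_three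
  by_cases h_four : r ≤ δ (r - 4)
  · exact potentiallyGraphic_of_le_apply_sub_four f hG hlarge hδ (by omega) h_four
  have h_succ_le : δ (r + 1) ≤ δ (r - 4) := hδ (by omega)
  by_cases h_succ : δ (r + 1) = r - 1
  · exact potentiallyGraphic_of_apply_succ_eq f hG hlarge hδ (by omega) h_succ
  · exact potentiallyGraphic_of_apply_succ_lt f hG hlarge hδ (by omega) (by omega)

end UpperBound

section LowerBound

theorem degIn_le_degIn_map {U V : Type*} {K : SimpleGraph U} {G : SimpleGraph V}
    (φ : SimpleGraph.Copy K G) (Q : Finset U) (u : U) :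
    degIn K Q u ≤ degIn G (Q.map φ.toEmbedding) (φ u) := by
  classical
  refine card_le_card_of_injOn φ (fun v hv => ?_) φ.injective.injOn
  rw [mem_coe, mem_filter] at hv ⊢
  exact ⟨mem_map_of_mem φ.toEmbedding hv.1, φ.toHom.map_adj hv.2⟩

theorem sum_degIn_sum {U V : Type*} (G : SimpleGraph U) (H : SimpleGraph V) (X : Finset (U ⊕ V)) :
    ∑ x ∈ X, degIn (G.sum H) X x =
      ∑ u ∈ X.toLeft, degIn G X.toLeft u + ∑ v ∈ X.toRight, degIn H X.toRight v := by
  classical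
  conv_lhs => rw [← X.toLeft_disjSum_toRight, sum_disjSum]
  simp only [degIn_eq_card_filter, card_filter, sum_disjSum]
  simp

theorem sum_degIn_pathGraph_four_le (X : Finset (Fin 4)) :
    ∑ i ∈ X, degIn (SimpleGraph.pathGraph 4) X i ≤ 2 * (#X - 1) := by
  classical
  simp only [degIn_eq_card_filter, SimpleGraph.pathGraph_adj]
  decide +revert

theorem sum_degIn_triangleUnionPath_le {X : Finset (Fin 3 ⊕ Fin 4)} (hX : #X ≤ 4) :
    ∑ x ∈ X, degIn triangleUnionPath X x ≤ 6 := by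
  rw [triangleUnionPath, sum_degIn_sum]
  have hleft : ∑ v ∈ X.toLeft, degIn (⊤ : SimpleGraph (Fin 3)) X.toLeft v ≤
      #X.toLeft * (#X.toLeft - 1) := by
    simpa using sum_le_card_nsmul X.toLeft _ (#X.toLeft - 1) fun v hv => degIn_le_card_sub_one _ hv
  have hright := sum_degIn_pathGraph_four_le X.toRight
  have hcard : #X.toLeft + #X.toRight ≤ 4 := card_toLeft_add_card_toRight.trans_le hX
  have hleft3 : #X.toLeft ≤ 3 := by simpa using card_le_univ X.toLeft
  interval_cases #X.toLeft <;> omega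

theorem sum_degIn_map {U V : Type*} (e : U ↪ V) (H : SimpleGraph U) (Q : Finset V) :
    ∑ v ∈ Q, degIn (H.map e) Q v =
      ∑ u ∈ Q.preimage e e.injective.injOn, degIn H (Q.preimage e e.injective.injOn) u := by
  classical
  rw [← sum_preimage e Q e.injective.injOn]
  · refine sum_congr rfl fun u _ => ?_
    rw [degIn_eq_card_filter, degIn_eq_card_filter, ← card_map e]
    congr 1
    ext w
    simp only [mem_map, mem_filter, mem_preimage]
    constructor
    · rintro ⟨hw, h⟩
      obtain ⟨-, x, -, -, rfl⟩ := (SimpleGraph.map_adj _ _ _ _).1 h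
      exact ⟨x, ⟨hw, SimpleGraph.map_adj_apply.1 h⟩, rfl⟩
    · rintro ⟨x, ⟨hw, h⟩, rfl⟩
      exact ⟨hw, SimpleGraph.map_adj_apply.2 h⟩
  · refine fun v _ hv => degIn_eq_zero_iff.2 fun w _ h => hv ?_
    obtain ⟨x, -, -, rfl, -⟩ := (SimpleGraph.map_adj _ _ _ _).1 h
    exact ⟨x, rfl⟩

theorem six_le_sum_degIn_completeMinus {m : ℕ} (f : Fin 3 ⊕ Fin 4 ↪ Fin m) {Q : Finset (Fin m)}
    (hQ : #Q = 4) : 6 ≤ ∑ u ∈ Q, degIn (completeMinus triangleUnionPath f) Q u := by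
  have hadd : ∀ u ∈ Q, degIn (completeMinus triangleUnionPath f) Q u +
      degIn (triangleUnionPath.map f) Q u = 3 := fun u hu => by
    rw [completeMinus, ← degIn_sup_of_disjoint disjoint_sdiff_self_left, sdiff_sup_cancel le_top,
      degIn_eq_card_sub_one hu fun w _ hne => hne.symm, hQ]
  have hsum := sum_congr rfl hadd
  rw [sum_add_distrib, sum_const, hQ, sum_degIn_map, smul_eq_mul] at hsum
  have hcard : #(Q.preimage f f.injective.injOn) ≤ 4 := (card_map f).symm.trans_le
    ((card_le_card (map_subset_iff_subset_preimage.2 subset_rfl)).trans hQ.le)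
  have := sum_degIn_triangleUnionPath_le hcard
  omega

theorem not_isContained_completeMinus {V : Type*} [Fintype V] [DecidableEq V] {m : ℕ}
    (f : Fin 3 ⊕ Fin 4 ↪ Fin m) {G : SimpleGraph V} {T : Finset V} {x₀ : V} (hT : #T + 4 ≤ m)
    (hG : ∀ x ∉ T, degIn G Tᶜ x ≤ 1 + if x = x₀ then 1 else 0) :
    ¬ (completeMinus triangleUnionPath f).IsContained G := by
  rintro ⟨φ⟩
  have hcard : 4 ≤ #{u | φ u ∉ T} := by
    have hin : #{u | φ u ∈ T} ≤ #T :=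
      card_le_card_of_injOn φ (fun u hu => (mem_filter.1 hu).2) φ.injective.injOn
    have hadd := card_filter_add_card_filter_not (s := (univ : Finset (Fin m))) fun u => φ u ∈ T
    rw [card_univ, Fintype.card_fin] at hadd
    omega
  obtain ⟨Q, hQ, hQ4⟩ := exists_subset_card_eq hcard
  have hQT : ∀ u ∈ Q, φ u ∉ T := fun u hu => (mem_filter.1 (hQ hu)).2
  have hdeg : ∀ u ∈ Q, degIn (completeMinus triangleUnionPath f) Q u ≤
      1 + if φ u = x₀ then 1 else 0 := fun u hu => by
    refine (degIn_le_degIn_map φ Q u).trans ((degIn_mono G (fun x hx => ?_) _).trans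
      (hG _ (hQT u hu)))
    obtain ⟨v, hv, rfl⟩ := mem_map.1 hx
    exact mem_compl.2 (hQT v hv)
  have hsum := sum_le_sum hdeg
  rw [sum_add_distrib, sum_const, hQ4, ← card_filter, smul_eq_mul] at hsum
  have hx₀ : #{u ∈ Q | φ u = x₀} ≤ 1 := card_le_one.2 fun u hu v hv =>
    φ.injective ((mem_filter.1 hu).2.trans (mem_filter.1 hv).2.symm)
  have := six_le_sum_degIn_completeMinus f hQ4
  omega

theorem degIn_eq_deg {V : Type*} [Fintype V] {F : SimpleGraph V} {U : Finset V}
    (h : ∀ v ∉ U, deg F v = 0) (v : V) : degIn F U v = deg F v := by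
  classical
  rw [← degIn_add_degIn_compl F U, left_eq_add, degIn_eq_zero_iff]
  exact fun w hw hadj => degIn_eq_zero_iff.1 (h w (mem_compl.1 hw)) v (mem_univ v) hadj.symm

theorem exists_deg_eq_of_even_card {V : Type*} [Fintype V] [DecidableEq V] {U : Finset V}
    (hU : Even #U) : ∃ Γ : SimpleGraph V, ∀ v, deg Γ v = if v ∈ U then 1 else 0 := by
  have hclique : (⊤ : SimpleGraph V).IsClique (U : Set V) := fun _ _ _ _ hne => hne
  obtain ⟨M, hMU, hM⟩ := (hclique.even_iff_exists_isMatching U.finite_toSet).1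
    (by rwa [Set.ncard_coe_finset])
  refine ⟨M.spanningCoe, fun v => ?_⟩
  rw [← ncard_neighborSet_eq_deg]
  split_ifs with hv
  · obtain ⟨w, hw, huniq⟩ := hM (hMU.symm ▸ mem_coe.2 hv)
    exact Set.ncard_eq_one.2 ⟨w, Set.eq_singleton_iff_unique_mem.2 ⟨hw, huniq⟩⟩
  · refine (Set.ncard_eq_zero).2 (Set.eq_empty_of_forall_notMem fun w hw => hv ?_)
    exact mem_coe.1 (hMU ▸ M.edge_vert hw)

theorem exists_deg_eq_one_add {V : Type*} [Fintype V] [DecidableEq V] {U : Finset V} {x₀ : V}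
    (hx₀ : x₀ ∈ U) (hU : 2 ≤ #U) : ∃ Γ : SimpleGraph V,
      ∀ v, deg Γ v = if v ∈ U then 1 + if v = x₀ then #U % 2 else 0 else 0 := by
  rcases Nat.even_or_odd #U with heven | hodd
  · simpa [Nat.even_iff.1 heven] using exists_deg_eq_of_even_card heven
  · obtain ⟨y, hy, hne⟩ := exists_mem_ne hU x₀
    obtain ⟨Γ, hΓ⟩ := exists_deg_eq_of_even_card (U := U.erase y) (by
      rw [card_erase_of_mem hy]
      exact hodd.tsub_odd odd_one)
    have hadj : ¬ Γ.Adj x₀ y := fun h =>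
      degIn_eq_zero_iff.1 ((hΓ y).trans (by simp)) x₀ (mem_univ _) h.symm
    refine ⟨Γ ⊔ SimpleGraph.edge x₀ y, fun v => ?_⟩
    rw [deg_sup_edge hne.symm hadj, hΓ, Nat.odd_iff.1 hodd]
    simp only [mem_erase, Pi.single_apply]
    split_ifs <;> simp_all

/-- The sequence with `m` entries `n - 1` and all others `m + 1`, except that the first of these
is increased by one if necessary to make the sum even. -/
def extremalSeq (n m : ℕ) (i : Fin n) : ℕ :=
  if i.val < m then n - 1 else m + 1 + if i.val = m then (n - m) % 2 else 0

theorem sum_extremalSeq {n m : ℕ} (h : m < n) : ∑ i, (extremalSeq n m i : ℤ) =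
    m * (n - 1) + (n - m) * (m + 1) + ((n - m) % 2 : ℕ) := by
  have hsplit (i : Fin n) : (extremalSeq n m i : ℤ) = (if i ∈ initial n m then (n : ℤ) - 1
      else m + 1) + if i = ⟨m, h⟩ then (((n - m) % 2 : ℕ) : ℤ) else 0 := by
    simp only [extremalSeq, mem_initial, Fin.ext_iff]
    split_ifs <;> omega
  simp_rw [hsplit, sum_add_distrib, sum_ite_eq' univ, sum_ite]
  rw [filter_mem_eq_inter, filter_not, filter_mem_eq_inter]
  simp [card_sdiff, card_initial h.le, Nat.cast_sub h.le, mul_sub_one]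

theorem antitone_extremalSeq {n m : ℕ} (h : m + 2 ≤ n) : Antitone (extremalSeq n m) := by
  intro i j hij
  rw [Fin.le_def] at hij
  unfold extremalSeq
  split_ifs <;> omega

theorem isGraphic_extremalSeq {n m : ℕ} (h : m + 2 ≤ n) : IsGraphic (extremalSeq n m) := by
  have hcard : #(initial n m) = m := card_initial (by omega)
  have hcard' : #(initial n m)ᶜ = n - m := by rw [card_compl, hcard, Fintype.card_fin]
  obtain ⟨Γ, hΓ⟩ := exists_deg_eq_one_add (U := (initial n m)ᶜ) (x₀ := ⟨m, by omega⟩)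
    (by simp [mem_initial]) (by omega)
  refine ⟨antitone_extremalSeq h, coreGraph (initial n m) (initial n m)ᶜ Γ, fun i => ?_⟩
  rw [ncard_neighborSet_eq_deg, extremalSeq]
  split_ifs with hi
  · rw [deg_coreGraph_of_mem_left disjoint_compl_right (mem_initial.2 hi), hcard, hcard']
    omega
  all_goals
    have hiT : i ∈ (initial n m)ᶜ := by simpa [mem_initial] using hi
    rw [deg_coreGraph_of_mem_right disjoint_compl_right hiT,
      degIn_eq_deg (fun v hv => by rw [hΓ, if_neg hv]), hΓ, if_pos hiT, hcard, hcard']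
    simp_all [Fin.ext_iff]
    try omega

theorem not_potentiallyGraphic_extremalSeq {n m k : ℕ} (hm : m < n) (hk : m + 4 ≤ k)
    (f : Fin 3 ⊕ Fin 4 ↪ Fin k) :
    ¬ PotentiallyGraphic (completeMinus triangleUnionPath f) (extremalSeq n m) := by
  rintro ⟨G, hreal, hcontained⟩
  have hG : ∀ v, deg G v = extremalSeq n m v := fun v =>
    (ncard_neighborSet_eq_deg G v).symm.trans (hreal v)
  have hcard : #(initial n m) = m := card_initial hm.le
  have hadj : ∀ a ∈ initial n m, ∀ x ≠ a, G.Adj a x := fun a ha x hne => by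
    have hdeg : degIn G (univ.erase a) a = #(univ.erase a) := by
      refine (degIn_erase_self ..).trans ((hG a).trans ?_)
      rw [extremalSeq, if_pos (mem_initial.1 ha), card_erase_of_mem (mem_univ a), card_univ,
        Fintype.card_fin]
    exact degIn_eq_card_iff.1 hdeg x (mem_erase.2 ⟨hne, mem_univ x⟩)
  refine not_isContained_completeMinus f (x₀ := ⟨m, hm⟩) (by rwa [hcard]) (fun x hx => ?_)
    hcontained
  have hsplit := degIn_add_degIn_compl G (initial n m) x
  rw [degIn_eq_card_iff.2 fun a ha => (hadj a ha x fun h => hx (h ▸ ha)).symm, hcard, hG,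
    extremalSeq, if_neg (mt mem_initial.2 hx)] at hsplit
  simp only [Fin.ext_iff]
  split_ifs at hsplit ⊢ <;> omega

theorem IsGraphic.even_sum {n : ℕ} {d : Fin n → ℕ} (hd : IsGraphic d) :
    Even (∑ i, (d i : ℤ)) := by
  obtain ⟨-, G, hG⟩ := hd
  have hdeg : ∀ i, deg G i = d i := fun i => (ncard_neighborSet_eq_deg G i).symm.trans (hG i)
  have heven := even_sum_deg G
  rw [sum_congr rfl fun i _ => hdeg i] at heven
  exact_mod_cast heven

theorem isSigma_sum_add_two {V : Type*} {H : SimpleGraph V} {n : ℕ} {d : Fin n → ℕ}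
    (hd : IsGraphic d) (hnot : ¬ PotentiallyGraphic H d)
    (hall : ∀ d' : Fin n → ℕ, IsGraphic d' → ∑ i, (d i : ℤ) + 2 ≤ ∑ i, (d' i : ℤ) →
      PotentiallyGraphic H d') :
    IsSigma H n (∑ i, (d i : ℤ) + 2) := by
  refine ⟨⟨hd.even_sum.add even_two, hall⟩, fun l ⟨hl, hl'⟩ => ?_⟩
  have hlt : ∑ i, (d i : ℤ) < l := lt_of_not_ge fun hle => hnot (hl' d hd hle)
  obtain ⟨a, ha⟩ := hl
  obtain ⟨b, hb⟩ := hd.even_sum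
  omega

theorem sum_extremalSeq_add_two {r n : ℕ} (hr : 3 ≤ r) (hn : r ≤ n) :
    ∑ i, (extremalSeq n (r - 3) i : ℤ) + 2 =
      if Odd ((n : ℤ) - r) then sumBound r n else sumBound r n + 1 := by
  have hparity : (n - (r - 3)) % 2 = if Odd ((n : ℤ) - r) then 0 else 1 := by
    simp only [Int.odd_iff]
    split_ifs <;> omega
  rw [sum_extremalSeq (by omega), hparity, sumBound]
  split_ifs <;> push_cast [hr] <;> ring

end LowerBound

theorem theorem1p1 (r n : ℕ) (hr : 6 ≤ r) (hn : 5 * r + 18 ≤ n)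
    (f : Fin 3 ⊕ Fin 4 ↪ Fin (r + 1)) :
    IsSigma (completeMinus triangleUnionPath f) n
      (if Odd ((n : ℤ) - (r : ℤ)) then
        ((r : ℤ) - 1) * (2 * (n : ℤ) - (r : ℤ)) - 3 * ((n : ℤ) - (r : ℤ)) - 1
      else
        ((r : ℤ) - 1) * (2 * (n : ℤ) - (r : ℤ)) - 3 * ((n : ℤ) - (r : ℤ))) := by
  have hvalue := sum_extremalSeq_add_two (r := r) (n := n) (by omega) (by omega)
  have hbound : sumBound r n ≤ ∑ i, (extremalSeq n (r - 3) i : ℤ) + 2 := by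
    rw [hvalue]
    split_ifs <;> omega
  have hsigma : IsSigma (completeMinus triangleUnionPath f) n
      (∑ i, (extremalSeq n (r - 3) i : ℤ) + 2) :=
    isSigma_sum_add_two (isGraphic_extremalSeq (by omega))
      (not_potentiallyGraphic_extremalSeq (by omega) (by omega) f)
      fun _ hd hsum => potentiallyGraphic_of_sumBound_le f hr hn hd (hbound.trans hsum)
  rw [hvalue, sumBound, sub_add_cancel] at hsigma
  exact hsigma
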